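/- Let $0<\alpha<1/2$ and let $f_\alpha:[0,1]\to[0,1]$ be the Delahaye-type map given, for $j\ge 1$, by $$f_\alpha(x)=x-1+2\alpha^{j-1}-\alpha^{j}\quad\text{for }x\in[1-\alpha^{j-1},\,1-\alpha^{j-1}+\alpha^{j}],$$ $$f_\alpha(x)=\frac{1-\alpha+\alpha^2}{2\alpha-1}(x-1)+\alpha^{j+1}\,\frac{2-\alpha}{2\alpha-1}\quad\text{for }x\in(1-\alpha^{j-1}+\alpha^{j},\,1-\alpha^{j}),$$ and $f_\alpha(1)=0$. Let $\mu_\alpha$ be the image of the fair coin-tossing measure on $\{0,1\}^{\{1,2,\dots\}}$ under $\kappa(u)=(1-\alpha)\sum_{i\ge1}u_i\alpha^{i-1}$; equivalently, $\mu_\alpha$ is the Borel probability measure concentrated on the Cantor set $X_\alpha=\kappa(\{0,1\}^{\{1,2,\dots\}})$ that gives mass $2^{-k}$ to each interval $[\kappa(u_1\dots u_k000\dots),\kappa(u_1\dots u_k000\dots)+\alpha^k]$. For $\varepsilon>0$ put $$c_1(\varepsilon)=\mu_\alpha\times\mu_\alpha\{(x,y):|x-y|\le\varepsilon\},\qquad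 c_\infty(\varepsilon)=\mu_\alpha\times\mu_\alpha\{(x,y):\sup_{i\ge0}|f_\alpha^i(x)-f_\alpha^i(y)|\le\varepsilon\},$$ and let $\det^\infty_\alpha(\varepsilon)=c_\infty(\varepsilon)/c_1(\varepsilon)$ be the $\infty$-asymptotic determinism. **Theorem.** For every $\alpha\in(0,1/2)$ the measure $\mu_\alpha$ is a non-atomic $f_\alpha$-ergodic probability measure on $[0,1]$, and the following hold. 1. For every integer $h\ge0$ the function $\det^\infty_\alpha$ has a local minimum at $\varepsilon=\alpha^h-\alpha^{h+2}$; moreover, this is the only point of $[\alpha^{h+1},\alpha^h]$ at which $\det^\infty_\alpha$ takes its least value on that interval. 2. $\displaystyle\liminf_{\varepsilon\to0^+}\det{}^\infty_\alpha(\varepsilon)\in[1/3,\,8/15]$. 3. $\displaystyle\limsup_{\varepsilon\to0^+}\det{}^\infty_\alpha(\varepsilon)=1$ if $\alpha\le1/3$, and $\displaystyle\limsup_{\varepsilon\to0^+}\det{}^\infty_\alpha(\varepsilon)<1$ if $\alpha>1/3$. 4. If $\alpha\le1/3$, then $\displaystyle\liminf_{\varepsilon\to0^+}\det{}^\infty_\alpha(\varepsilon)=8/15$,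 and the extreme values of $\det^\infty_\alpha$ on $(0,1]$ are $8/15$ and $1$: one has $8/15\le\det^\infty_\alpha(\varepsilon)\le1$ for all $\varepsilon\in(0,1]$, and for every integer $h\ge0$ the value $8/15$ is attained at $\varepsilon=\alpha^h-\alpha^{h+2}$ and the value $1$ at $\varepsilon=\alpha^h$. -/

import Mathlib

open scoped ENNReal Topology

namespace Delahaye

section General

/-- The distance `ρ_ℓ(x, y) = sup {ρ(gⁱ x, gⁱ y) | 0 ≤ i < ℓ}` for `1 ≤ ℓ ≤ ∞`, taken in `[0, ∞]`. -/
noncomputable def orbitDist {M : Type*} [PseudoEMetricSpace M] (g : M → M) (l : ℕ∞) (x y : M) :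
    ℝ≥0∞ :=
  ⨆ (i : ℕ) (_ : (i : ℕ∞) < l), edist (g^[i] x) (g^[i] y)

/-- The `ℓ`-correlation integral `c_ℓ(ν, ε) = (ν × ν) {(x, y) | ρ_ℓ(x, y) ≤ ε}`. -/
noncomputable def corrIntegral {M : Type*} [PseudoEMetricSpace M] [MeasurableSpace M]
    (g : M → M) (ν : MeasureTheory.Measure M) (l : ℕ∞) (ε : ℝ) : ℝ :=
  (ν.prod ν).real {p : M × M | orbitDist g l p.1 p.2 ≤ ENNReal.ofReal ε}

/-- The `∞`-asymptotic determinism `det_∞(ν, ε) = c_∞(ν, ε) / c_1(ν, ε)`. -/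
noncomputable def asympDetInfty {M : Type*} [PseudoEMetricSpace M] [MeasurableSpace M]
    (g : M → M) (ν : MeasureTheory.Measure M) (ε : ℝ) : ℝ :=
  corrIntegral g ν ⊤ ε / corrIntegral g ν 1 ε

end General

open scoped Classical in
/-- The Delahaye-type map `f_α` of `[0, 1]`, for `0 < α < 1/2`. The half-open interval `[0, 1)` is
the disjoint union of the closed intervals `[1 - α^j, 1 - α^j + α^(j+1)]` and of the open intervals
`(1 - α^j + α^(j+1), 1 - α^(j+1))`, `j = 0, 1, 2, …`, so that `Nat.find` selects the only
possible index. The value is `0` at `1`; outside `[0, 1]`, where `f_α` is not defined, it is set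
to `0` as well. -/
noncomputable def f (α x : ℝ) : ℝ :=
  if h : ∃ j : ℕ, x ∈ Set.Icc (1 - α ^ j) (1 - α ^ j + α ^ (j + 1)) then
    x - 1 + 2 * α ^ (Nat.find h) - α ^ (Nat.find h + 1)
  else if h : ∃ j : ℕ, x ∈ Set.Ioo (1 - α ^ j + α ^ (j + 1)) (1 - α ^ (j + 1)) then
    (1 - α + α ^ 2) / (2 * α - 1) * (x - 1)
      + α ^ (Nat.find h + 2) * ((2 - α) / (2 * α - 1))
  else 0

/-- The coding map `κ(u) = (1 - α) ∑ u_i α^i` from infinite binary words, indexed from `0`, onto the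
Cantor set `X_α`. -/
noncomputable def kappa (α : ℝ) (u : ℕ → Bool) : ℝ :=
  (1 - α) * ∑' i : ℕ, (if u i then 1 else 0) * α ^ i

/-- The fair coin-tossing measure on infinite binary words. -/
noncomputable def coin : MeasureTheory.Measure (ℕ → Bool) :=
  MeasureTheory.Measure.infinitePi fun _ : ℕ => (PMF.uniformOfFintype Bool).toMeasure

/-- The measure `μ_α`: it is concentrated on the Cantor set `X_α = κ({0,1}^ℕ)` and gives mass `2⁻ᵏ`
to each of the `2ᵏ` basic intervals `[κ(u), κ(u) + αᵏ]` of level `k`. -/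
noncomputable def mu (α : ℝ) : MeasureTheory.Measure ℝ :=
  coin.map (kappa α)

/-- The function `ε ↦ det_∞(μ_α, ε)` for the map `f_α`. -/
noncomputable def det (α ε : ℝ) : ℝ :=
  asympDetInfty (f α) (mu α) ε

end Delahaye

/-!
The coding map `kappa α` conjugates `f α` on the Cantor set with the odometer on binary words, and
conditioning on the first letter of a word turns every quantity of interest into the solution of a
self-similarity equation. The equation `Φ t = (Φ (t / α) + Φ ((t - (1 - α)) / α)) / 2`, with the
boundary values of a distribution function on `[0, 1]`, has only one bounded solution
(`IsSelfSimilarCdf.unique`), the distribution function `cdf α` of `μ_α`. Its symmetry, the absence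
of atoms, and the law of the supremum of `κ(Tⁿ u) - κ(Tⁿ v)` along two independent odometer orbits
(`coin2_real_orbitSubLe`) all follow from this uniqueness. Ergodicity holds because a set invariant
under the odometer has two equal halves, again invariant, and is thus independent of every cylinder.

Write `τ = (s - (1 - α²)) / α²`. For `s ∈ [α, 1]` the correlation integral along orbits is
`c_∞(α ^ h s) = 2^(-h-1) (1 + cdf τ)` (`corrTop_pow_mul`), while for `c_1` one has
`c_1(α ^ h s) ≥ 2^(-h) c_1(s)`, with equality for `α ≤ 1/3`, and `c_1(1 - α²) = 15/16`. Hence on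
`[α, 1 - α²]` the numerator of `det(α ^ h s)` is constant and the denominator increases strictly. On
`[1 - α², 1]` the decisive fact is that `cdf` is subadditive (`cdf_sub_le`): no interval has larger
mass than the interval of the same length starting at `0`. It gives
`c_1(b) - c_1(a) ≤ 2 cdf (b - a)` (`corrOne_sub_le`), whence
`c_1(α ^ h s) - c_1(α ^ h (1 - α²)) ≤ 2^(-h) cdf τ / 2 < cdf τ · c_1(α ^ h (1 - α²))`, and so
`det(α ^ h s)` is strictly least at `s = 1 - α²`. The same inequality with `a = 0` bounds this least
value below by `1/3`, and `c_1(α ^ h (1 - α²)) ≥ 2^(-h) · 15/16` bounds it above by `8/15`.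
-/

namespace Delahaye

open MeasureTheory Set

/-! ### Binary words and the fair coin -/

/-- The word `b u₀ u₁ u₂ …`. -/
def wcons (b : Bool) (u : ℕ → Bool) : ℕ → Bool
  | 0 => b
  | n + 1 => u n

@[simp] theorem wcons_zero (b : Bool) (u : ℕ → Bool) : wcons b u 0 = b := rfl

@[simp] theorem wcons_succ (b : Bool) (u : ℕ → Bool) (n : ℕ) : wcons b u (n + 1) = u n := rfl

theorem exists_eq_wcons (u : ℕ → Bool) : ∃ b v, u = wcons b v :=
  ⟨u 0, fun n => u (n + 1), by ext n; cases n <;> rfl⟩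

theorem measurable_wcons_uncurry :
    Measurable fun p : Bool × (ℕ → Bool) => wcons p.1 p.2 := by
  refine measurable_pi_lambda _ fun n => ?_
  cases n with
  | zero => exact measurable_fst
  | succ n => exact (measurable_pi_apply n).comp measurable_snd

theorem measurable_wcons (b : Bool) : Measurable (wcons b) :=
  measurable_wcons_uncurry.comp measurable_prodMk_left

instance : IsProbabilityMeasure coin := by unfold coin; infer_instance

theorem measurePreserving_wcons_uncurry :
    MeasurePreserving (fun p : Bool × (ℕ → Bool) => wcons p.1 p.2)
      ((PMF.uniformOfFintype Bool).toMeasure.prod coin) coin := by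
  refine ⟨measurable_wcons_uncurry, Measure.eq_infinitePi _ fun s t ht => ?_⟩
  have hpre : (fun p : Bool × (ℕ → Bool) => wcons p.1 p.2) ⁻¹' (Set.pi s t) =
      (if 0 ∈ s then t 0 else univ) ×ˢ
        Set.pi (s.preimage Nat.succ Nat.succ_injective.injOn) (fun n => t (n + 1)) := by
    ext ⟨b, u⟩
    simp only [mem_preimage, Set.mem_pi, Finset.mem_coe, mem_prod, Finset.mem_preimage]
    constructor
    · intro h
      refine ⟨?_, fun n hn => h (n + 1) hn⟩
      split_ifs with h0
      · exact h 0 h0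
      · trivial
    · rintro ⟨h0, h1⟩ n hn
      cases n with
      | zero => simpa [hn] using h0
      | succ n => exact h1 n hn
  rw [Measure.map_apply measurable_wcons_uncurry
    (MeasurableSet.pi s.countable_toSet fun i _ => ht i), hpre, Measure.prod_prod, coin,
    Measure.infinitePi_pi _ (fun i _ => ht _)]
  have hs : s = (if 0 ∈ s then {0} else ∅) ∪
      (s.preimage Nat.succ Nat.succ_injective.injOn).map ⟨Nat.succ, Nat.succ_injective⟩ := by
    ext n
    cases n with
    | zero => by_cases h : 0 ∈ s <;> simp [h]
    | succ n => by_cases h : 0 ∈ s <;> simp [h]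
  conv_rhs => rw [hs]
  rw [Finset.prod_union, Finset.prod_map]
  · congr 1
    by_cases h : 0 ∈ s
    · simp [h]
    · simp only [h, if_false, measure_univ, Finset.prod_empty]
  · by_cases h : 0 ∈ s <;> simp [h]

theorem coin_eq_half (E : Set (ℕ → Bool)) (hE : MeasurableSet E) :
    coin E = 2⁻¹ * (coin (wcons false ⁻¹' E) + coin (wcons true ⁻¹' E)) := by
  rw [← measurePreserving_wcons_uncurry.measure_preimage hE.nullMeasurableSet,
    Measure.prod_apply (measurable_wcons_uncurry hE), lintegral_fintype]
  have h (b : Bool) : (PMF.uniformOfFintype Bool).toMeasure {b} = 2⁻¹ := by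
    rw [PMF.toMeasure_apply_singleton _ _ (measurableSet_singleton b)]; simp
  simp only [Fintype.univ_bool, Finset.mem_singleton, Bool.true_eq_false, not_false_eq_true,
    Finset.sum_insert, Finset.sum_singleton, h]
  simp only [preimage_preimage]
  rw [add_comm, ← add_mul, mul_comm]

/-- The law of a random word is the average of its two conditional laws given the first letter. -/
theorem coin_real_eq (E : Set (ℕ → Bool)) (hE : MeasurableSet E) :
    coin.real E = (coin.real (wcons false ⁻¹' E) + coin.real (wcons true ⁻¹' E)) / 2 := by
  rw [Measure.real, coin_eq_half E hE, ENNReal.toReal_mul, ENNReal.toReal_add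
    (measure_ne_top _ _) (measure_ne_top _ _), ENNReal.toReal_inv]
  simp only [Measure.real, ENNReal.toReal_ofNat]
  ring

/-- The law of a pair of independent random words. -/
noncomputable abbrev coin2 : Measure ((ℕ → Bool) × (ℕ → Bool)) := coin.prod coin

theorem measurable_wcons_prod (a b : Bool) :
    Measurable fun p : (ℕ → Bool) × (ℕ → Bool) => (wcons a p.1, wcons b p.2) :=
  ((measurable_wcons a).comp measurable_fst).prodMk ((measurable_wcons b).comp measurable_snd)

theorem coin2_real_eq (E : Set ((ℕ → Bool) × (ℕ → Bool))) (hE : MeasurableSet E) :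
    coin2.real E =
      (coin2.real {p | (wcons false p.1, wcons false p.2) ∈ E} +
        coin2.real {p | (wcons true p.1, wcons true p.2) ∈ E} +
        coin2.real {p | (wcons true p.1, wcons false p.2) ∈ E} +
        coin2.real {p | (wcons false p.1, wcons true p.2) ∈ E}) / 4 := by
  have hc : coin = (2⁻¹ : ℝ≥0∞) • (coin.map (wcons false) + coin.map (wcons true)) := by
    ext E hE
    simp [coin_eq_half E hE, Measure.map_apply (measurable_wcons _) hE, mul_add]
  have h (a b : Bool) : (coin.map (wcons a)).prod (coin.map (wcons b)) =
      coin2.map fun p => (wcons a p.1, wcons b p.2) :=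
    Measure.map_prod_map _ _ (measurable_wcons a) (measurable_wcons b)
  have h2 : coin2 = (2⁻¹ : ℝ≥0∞) • ((2⁻¹ : ℝ≥0∞) •
      (coin2.map (fun p => (wcons false p.1, wcons false p.2)) +
        coin2.map (fun p => (wcons true p.1, wcons true p.2)) +
        coin2.map (fun p => (wcons true p.1, wcons false p.2)) +
        coin2.map (fun p => (wcons false p.1, wcons true p.2)))) := by
    conv_lhs => rw [coin2, hc]
    have (b : Bool) : SFinite (coin.map (wcons b)) := inferInstance
    rw [Measure.prod_smul_left, Measure.prod_smul_right, Measure.add_prod, Measure.prod_add,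
      Measure.prod_add]
    simp only [h]
    congr 2
    abel
  have h3 := congrArg (fun m : Measure _ => m.real E) h2
  simp only [measureReal_ennreal_smul_apply] at h3
  rw [h3]
  have h4 (a b : Bool) : (coin2.map (fun p => (wcons a p.1, wcons b p.2))).real E =
      coin2.real {p | (wcons a p.1, wcons b p.2) ∈ E} :=
    map_measureReal_apply (measurable_wcons_prod a b) hE
  have (a b : Bool) : IsFiniteMeasure (coin2.map (fun p => (wcons a p.1, wcons b p.2))) :=
    inferInstance
  rw [measureReal_add_apply, measureReal_add_apply, measureReal_add_apply, h4, h4, h4, h4]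
  simp only [ENNReal.toReal_inv, ENNReal.toReal_ofNat]
  ring

/-! ### The odometer -/

/-- The adding machine: a letter is flipped when all the letters before it are `1`. -/
def odometer (u : ℕ → Bool) : ℕ → Bool := fun n => if ∀ i < n, u i = true then !u n else u n

@[simp] theorem odometer_wcons_false (u : ℕ → Bool) :
    odometer (wcons false u) = wcons true u := by
  ext n
  cases n with
  | zero => simp [odometer]
  | succ n =>
    have : ¬ ∀ i < n + 1, wcons false u i = true := fun h => by simpa using h 0 (Nat.succ_pos n)
    simp only [odometer, if_neg this, wcons_succ]

@[simp] theorem odometer_wcons_true (u : ℕ → Bool) :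
    odometer (wcons true u) = wcons false (odometer u) := by
  ext n
  cases n with
  | zero => simp [odometer]
  | succ n =>
    have : (∀ i < n + 1, wcons true u i = true) ↔ ∀ i < n, u i = true :=
      ⟨fun h i hi => h (i + 1) (by omega), fun h i hi => by
        cases i with
        | zero => rfl
        | succ i => exact h i (by omega)⟩
    simp only [odometer, this, wcons_succ]

theorem measurable_odometer : Measurable odometer := by
  refine measurable_pi_lambda _ fun n => ?_
  refine Measurable.ite ?_ ?_ (measurable_pi_apply n)
  · simp only [ofPred_forall]
    exact MeasurableSet.iInter fun i => MeasurableSet.iInter fun _ =>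
      measurableSet_eq_fun (measurable_pi_apply i) measurable_const
  · exact (measurable_of_countable not).comp (measurable_pi_apply n)

/-- The law of `odometer u` satisfies the same self-similarity as `coin`, with the roles of the
first letters exchanged, so that the difference of the two laws halves at every step. -/
theorem measurePreserving_odometer : MeasurePreserving odometer coin coin := by
  refine ⟨measurable_odometer, ?_⟩
  have key : ∀ n : ℕ, ∀ E : Set (ℕ → Bool), MeasurableSet E →
      |coin.real (odometer ⁻¹' E) - coin.real E| ≤ (1 / 2) ^ n := by
    intro n
    induction n with
    | zero =>
      intro E _
      have h1 := measureReal_le_one (μ := coin) (s := E)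
      have h2 := measureReal_le_one (μ := coin) (s := odometer ⁻¹' E)
      have h3 := measureReal_nonneg (μ := coin) (s := E)
      have h4 := measureReal_nonneg (μ := coin) (s := odometer ⁻¹' E)
      rw [pow_zero, abs_le]; constructor <;> linarith
    | succ n ih =>
      intro E hE
      have h := ih (wcons false ⁻¹' E) (measurable_wcons false hE)
      rw [coin_real_eq _ (measurable_odometer hE), coin_real_eq E hE]
      simp only [preimage_preimage, odometer_wcons_false, odometer_wcons_true]
      simp only [preimage_preimage] at h
      rw [abs_le] at h ⊢
      rw [pow_succ]
      constructor <;> linarith [h.1, h.2]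
  ext E hE
  rw [Measure.map_apply measurable_odometer hE]
  have h0 : |coin.real (odometer ⁻¹' E) - coin.real E| ≤ 0 :=
    ge_of_tendsto' (tendsto_pow_atTop_nhds_zero_of_lt_one (by norm_num) (by norm_num))
      fun n => key n E hE
  have := sub_eq_zero.1 (abs_nonpos_iff.1 h0)
  exact (ENNReal.toReal_eq_toReal_iff' (measure_ne_top _ _) (measure_ne_top _ _)).1 this

/-- A set invariant under the odometer is independent of every cylinder: its two halves
coincide and are again invariant. -/
theorem coin_real_inter_pi_of_invariant (n : ℕ) : ∀ (E : Set (ℕ → Bool)), MeasurableSet E →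
    odometer ⁻¹' E = E → ∀ (s : Finset ℕ) (t : ℕ → Set Bool), s ⊆ Finset.range n →
      coin.real (E ∩ Set.pi s t) = coin.real E * coin.real (Set.pi s t) := by
  induction n with
  | zero =>
    intro E _ _ s t hs
    have : s = ∅ := by simpa using hs
    simp [this]
  | succ n ih =>
    intro E hE hinv s t hs
    have h01 : wcons true ⁻¹' E = wcons false ⁻¹' E := by
      conv_rhs => rw [← hinv]
      simp [preimage_preimage]
    have hinv' : odometer ⁻¹' (wcons false ⁻¹' E) = wcons false ⁻¹' E := by
      conv_rhs => rw [← h01, ← hinv]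
      simp [preimage_preimage]
    set s' := s.preimage Nat.succ Nat.succ_injective.injOn
    have hpre (b : Bool) : wcons b ⁻¹' (Set.pi s t) =
        {_u | 0 ∈ s → b ∈ t 0} ∩ Set.pi s' (fun n => t (n + 1)) := by
      ext u
      simp only [mem_preimage, Set.mem_pi, Finset.mem_coe, mem_inter_iff, mem_ofPred_eq, s',
        Finset.mem_preimage]
      refine ⟨fun h => ⟨fun h0 => h 0 h0, fun n hn => h (n + 1) hn⟩, ?_⟩
      rintro ⟨h0, h1⟩ n hn
      cases n with
      | zero => exact h0 hn
      | succ n => exact h1 n hn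
    have hs' : s' ⊆ Finset.range n := fun i hi => by
      have := hs (Finset.mem_preimage.1 hi)
      simpa using this
    have hm : MeasurableSet (Set.pi (s : Set ℕ) t) :=
      MeasurableSet.pi s.countable_toSet fun i _ => (t i).toFinite.measurableSet
    have hb (b : Bool) : coin.real (wcons false ⁻¹' E ∩ wcons b ⁻¹' (Set.pi s t)) =
        coin.real (wcons false ⁻¹' E) * coin.real (wcons b ⁻¹' (Set.pi s t)) := by
      rw [hpre]
      by_cases hc : 0 ∈ s → b ∈ t 0
      · have : {_u : ℕ → Bool | 0 ∈ s → b ∈ t 0} = univ := eq_univ_of_forall fun _ => hc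
        rw [this, univ_inter]
        exact ih _ (measurable_wcons _ hE) hinv' s' _ hs'
      · have : {_u : ℕ → Bool | 0 ∈ s → b ∈ t 0} = ∅ := eq_empty_of_forall_notMem fun _ => hc
        simp [this]
    rw [coin_real_eq _ (hE.inter hm), coin_real_eq E hE, coin_real_eq _ hm]
    simp only [preimage_inter, h01, hb]
    ring

theorem ergodic_odometer : Ergodic odometer coin := by
  refine ⟨measurePreserving_odometer, ⟨fun E hE hinv => ?_⟩⟩
  have hbox : ∀ (s : Finset ℕ) (t : ℕ → Set Bool),
      coin (E ∩ Set.pi s t) = coin E * coin (Set.pi s t) := by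
    intro s t
    have h := coin_real_inter_pi_of_invariant (s.sup id + 1) E hE hinv s t fun i hi =>
      Finset.mem_range.2 (Nat.lt_succ_of_le (Finset.le_sup (f := id) hi))
    rw [Measure.real, Measure.real, Measure.real, ← ENNReal.toReal_mul] at h
    exact (ENNReal.toReal_eq_toReal_iff' (measure_ne_top _ _)
      (ENNReal.mul_ne_top (measure_ne_top _ _) (measure_ne_top _ _))).1 h
  rw [Filter.eventuallyConst_set']
  rcases eq_or_ne (coin E) 0 with h0 | h0
  · exact Or.inl (ae_eq_empty.2 h0)
  · right
    -- the conditional law given `E` agrees with `coin` on cylinders, hence gives mass `1` to `E`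
    have hcond : (coin E)⁻¹ • coin.restrict E = coin := by
      refine Measure.eq_infinitePi _ fun s t ht => ?_
      have hm : MeasurableSet (Set.pi (s : Set ℕ) t) :=
        MeasurableSet.pi s.countable_toSet fun i _ => ht i
      rw [Measure.smul_apply, Measure.restrict_apply hm, inter_comm, hbox, smul_eq_mul,
        ← mul_assoc, ENNReal.inv_mul_cancel h0 (measure_ne_top _ _), one_mul, coin,
        Measure.infinitePi_pi _ fun i _ => ht i]
    have h1 : coin Eᶜ = 0 := by
      rw [← hcond]
      simp [Measure.restrict_apply hE.compl]
    exact ae_eq_univ.2 h1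

/-! ### The coding map and the conjugacy with the odometer -/

variable {α : ℝ}

theorem summable_code (hα0 : 0 < α) (hα1 : α < 1 / 2) (u : ℕ → Bool) :
    Summable fun i : ℕ => (if u i then 1 else 0) * α ^ i := by
  refine Summable.of_nonneg_of_le (fun i => ?_) (fun i => ?_)
    (summable_geometric_of_lt_one hα0.le (by linarith))
  · split_ifs <;> positivity
  · split_ifs
    · simp
    · simpa using (pow_pos hα0 i).le

theorem kappa_wcons (hα0 : 0 < α) (hα1 : α < 1 / 2) (b : Bool) (u : ℕ → Bool) :
    kappa α (wcons b u) = (if b then 1 - α else 0) + α * kappa α u := by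
  unfold kappa
  rw [(summable_code hα0 hα1 _).tsum_eq_zero_add]
  have : ∑' i : ℕ, (if wcons b u (i + 1) then (1 : ℝ) else 0) * α ^ (i + 1) =
      α * ∑' i : ℕ, (if u i then 1 else 0) * α ^ i := by
    rw [← tsum_mul_left]
    refine tsum_congr fun i => ?_
    rw [wcons_succ, pow_succ]; ring
  rw [this]
  cases b <;> simp <;> ring

theorem kappa_wcons_false (hα0 : 0 < α) (hα1 : α < 1 / 2) (u : ℕ → Bool) :
    kappa α (wcons false u) = α * kappa α u := by simp [kappa_wcons hα0 hα1]

theorem kappa_wcons_true (hα0 : 0 < α) (hα1 : α < 1 / 2) (u : ℕ → Bool) :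
    kappa α (wcons true u) = 1 - α + α * kappa α u := by simp [kappa_wcons hα0 hα1]

theorem kappa_const_true (hα0 : 0 < α) (hα1 : α < 1 / 2) : kappa α (fun _ => true) = 1 := by
  simp only [kappa, if_true, one_mul]
  rw [tsum_geometric_of_lt_one hα0.le (by linarith), mul_inv_cancel₀ (by linarith)]

theorem kappa_const_false : kappa α (fun _ => false) = 0 := by simp [kappa]

theorem kappa_nonneg (hα0 : 0 < α) (hα1 : α < 1 / 2) (u : ℕ → Bool) : 0 ≤ kappa α u := by
  refine mul_nonneg (by linarith) (tsum_nonneg fun i => ?_)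
  split_ifs <;> positivity

theorem kappa_le_one (hα0 : 0 < α) (hα1 : α < 1 / 2) (u : ℕ → Bool) : kappa α u ≤ 1 := by
  rw [← kappa_const_true hα0 hα1]
  refine mul_le_mul_of_nonneg_left ?_ (by linarith)
  refine (summable_code hα0 hα1 u).tsum_le_tsum (fun i => ?_) (summable_code hα0 hα1 _)
  by_cases h : u i = true <;> simp [h, (pow_pos hα0 i).le]

theorem measurable_kappa (hα0 : 0 < α) (hα1 : α < 1 / 2) : Measurable (kappa α) := by
  refine Continuous.measurable ?_
  refine continuous_const.mul (continuous_tsum (u := fun i => α ^ i) (fun i => ?_)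
    (summable_geometric_of_lt_one hα0.le (by linarith)) fun i u => ?_)
  · have h : Continuous fun b : Bool => (if b then (1 : ℝ) else 0) * α ^ i :=
      continuous_of_discreteTopology
    exact h.comp (continuous_apply i)
  · rw [Real.norm_eq_abs, abs_mul, abs_pow, abs_of_pos hα0]
    split_ifs <;> simp [(pow_pos hα0 i).le]

theorem f_of_mem_Icc (hα0 : 0 < α) (hα1 : α < 1 / 2) {x : ℝ} {j : ℕ}
    (hx : x ∈ Icc (1 - α ^ j) (1 - α ^ j + α ^ (j + 1))) :
    f α x = x - 1 + 2 * α ^ j - α ^ (j + 1) := by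
  classical
  have h : ∃ j : ℕ, x ∈ Set.Icc (1 - α ^ j) (1 - α ^ j + α ^ (j + 1)) := ⟨j, hx⟩
  have hj : Nat.find h = j := by
    refine (Nat.find_eq_iff h).2 ⟨hx, fun n hn hxn => ?_⟩
    have h1 : α ^ j ≤ α ^ (n + 1) := pow_le_pow_of_le_one hα0.le (by linarith) hn
    have h2 := hxn.2
    have h3 := hx.1
    have h4 := pow_pos hα0 n
    rw [pow_succ] at h1 h2
    nlinarith
  unfold f
  rw [dif_pos h]
  rw [hj]

theorem f_of_mem_Ioo (hα0 : 0 < α) (hα1 : α < 1 / 2) {x : ℝ} {j : ℕ}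
    (hx : x ∈ Ioo (1 - α ^ j + α ^ (j + 1)) (1 - α ^ (j + 1)))
    (h' : ¬ ∃ j : ℕ, x ∈ Set.Icc (1 - α ^ j) (1 - α ^ j + α ^ (j + 1))) :
    f α x = (1 - α + α ^ 2) / (2 * α - 1) * (x - 1)
      + α ^ (j + 2) * ((2 - α) / (2 * α - 1)) := by
  classical
  have h : ∃ j : ℕ, x ∈ Ioo (1 - α ^ j + α ^ (j + 1)) (1 - α ^ (j + 1)) := ⟨j, hx⟩
  have hj : Nat.find h = j := by
    refine (Nat.find_eq_iff h).2 ⟨hx, fun n hn hxn => ?_⟩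
    have h1 : α ^ j ≤ α ^ (n + 1) := pow_le_pow_of_le_one hα0.le (by linarith) hn
    have h2 := hxn.2
    have h3 := hx.1
    have h4 := pow_pos hα0 (j + 1)
    linarith
  unfold f
  rw [dif_neg h', dif_pos h]
  rw [hj]

theorem f_one (hα0 : 0 < α) (hα1 : α < 1 / 2) : f α 1 = 0 := by
  unfold f
  rw [dif_neg, dif_neg]
  · rintro ⟨j, hj⟩
    have := pow_pos hα0 (j + 1)
    linarith [hj.2]
  · rintro ⟨j, hj⟩
    have h2 := hj.2
    have h3 := pow_pos hα0 j
    rw [pow_succ] at h2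
    nlinarith

theorem measurable_f (hα0 : 0 < α) (hα1 : α < 1 / 2) : Measurable (f α) := by
  intro s hs
  set I : ℕ → Set ℝ := fun j => Icc (1 - α ^ j) (1 - α ^ j + α ^ (j + 1))
  set O : ℕ → Set ℝ := fun j => Ioo (1 - α ^ j + α ^ (j + 1)) (1 - α ^ (j + 1))
  have hI : MeasurableSet (⋃ j, I j) := MeasurableSet.iUnion fun j => measurableSet_Icc
  have hO : MeasurableSet (⋃ j, O j) := MeasurableSet.iUnion fun j => measurableSet_Ioo
  have key : f α ⁻¹' s =
      (⋃ j, I j ∩ (fun x => x - 1 + 2 * α ^ j - α ^ (j + 1)) ⁻¹' s) ∪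
      ((⋃ j, I j)ᶜ ∩ ⋃ j, O j ∩ (fun x => (1 - α + α ^ 2) / (2 * α - 1) * (x - 1)
        + α ^ (j + 2) * ((2 - α) / (2 * α - 1))) ⁻¹' s) ∪
      ((⋃ j, I j)ᶜ ∩ (⋃ j, O j)ᶜ ∩ (fun _ => (0 : ℝ)) ⁻¹' s) := by
    ext x
    by_cases h1 : ∃ j, x ∈ I j
    · obtain ⟨j, hj⟩ := h1
      have hmem : x ∈ ⋃ j, I j := mem_iUnion.2 ⟨j, hj⟩
      simp only [mem_union, mem_inter_iff, mem_compl_iff, hmem, not_true_eq_false, false_and,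
        or_false, mem_iUnion, mem_preimage]
      refine ⟨fun h => ⟨j, hj, by rwa [← f_of_mem_Icc hα0 hα1 hj]⟩, ?_⟩
      rintro ⟨k, hk, h⟩
      rwa [f_of_mem_Icc hα0 hα1 hk]
    · have hmem : x ∉ ⋃ j, I j := by simpa using h1
      have hno (p : ℕ → Prop) : ¬ ∃ j, x ∈ I j ∧ p j := fun ⟨j, hj, _⟩ => h1 ⟨j, hj⟩
      by_cases h2 : ∃ j, x ∈ O j
      · obtain ⟨j, hj⟩ := h2
        have hmem' : x ∈ ⋃ j, O j := mem_iUnion.2 ⟨j, hj⟩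
        simp only [mem_union, mem_inter_iff, mem_compl_iff, hmem, hmem', not_true_eq_false,
          not_false_eq_true, true_and, false_and, and_false, or_false, mem_iUnion, mem_preimage,
          hno, false_or]
        refine ⟨fun h => ⟨j, hj, by rwa [← f_of_mem_Ioo hα0 hα1 hj h1]⟩, ?_⟩
        rintro ⟨k, hk, h⟩
        rwa [f_of_mem_Ioo hα0 hα1 hk h1]
      · have hmem' : x ∉ ⋃ j, O j := by simpa using h2
        have hno' (p : ℕ → Prop) : ¬ ∃ j, x ∈ O j ∧ p j := fun ⟨j, hj, _⟩ => h2 ⟨j, hj⟩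
        have hf : f α x = 0 := by
          unfold f
          rw [dif_neg h1, dif_neg h2]
        simp only [mem_union, mem_inter_iff, mem_compl_iff, hmem, hmem', not_false_eq_true,
          true_and, mem_iUnion, mem_preimage, hno, hno', and_false, false_or, hf]
  rw [key]
  refine ((MeasurableSet.iUnion fun j => measurableSet_Icc.inter ?_).union
    (hI.compl.inter (MeasurableSet.iUnion fun j => measurableSet_Ioo.inter ?_))).union
    ((hI.compl.inter hO.compl).inter (measurable_const hs))
  · exact (show Measurable fun x : ℝ => x - 1 + 2 * α ^ j - α ^ (j + 1) by fun_prop) hs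
  · exact (show Measurable fun x : ℝ => (1 - α + α ^ 2) / (2 * α - 1) * (x - 1)
        + α ^ (j + 2) * ((2 - α) / (2 * α - 1)) by fun_prop) hs

/-- A word whose first `0` is at position `j` is coded in the `j`-th interval of `f`, on which `f`
is the translation that corresponds to the odometer. -/
theorem kappa_mem_Icc_and_kappa_odometer (hα0 : 0 < α) (hα1 : α < 1 / 2) (j : ℕ) :
    ∀ u : ℕ → Bool, (∀ i < j, u i = true) → u j = false →
      kappa α u ∈ Icc (1 - α ^ j) (1 - α ^ j + α ^ (j + 1)) ∧
      kappa α (odometer u) = kappa α u - 1 + 2 * α ^ j - α ^ (j + 1) := by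
  induction j with
  | zero =>
    intro u _ hu
    obtain ⟨b, v, rfl⟩ := exists_eq_wcons u
    obtain rfl : b = false := hu
    rw [odometer_wcons_false, kappa_wcons_true hα0 hα1, kappa_wcons_false hα0 hα1]
    have h1 := kappa_nonneg hα0 hα1 v
    have h2 := kappa_le_one hα0 hα1 v
    refine ⟨⟨by simp; positivity, ?_⟩, by simp; ring⟩
    simp only [pow_zero, zero_add, pow_one]
    nlinarith
  | succ j ih =>
    intro u hu1 hu
    obtain ⟨b, v, rfl⟩ := exists_eq_wcons u
    obtain rfl : b = true := hu1 0 (Nat.succ_pos j)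
    obtain ⟨⟨h1, h2⟩, h3⟩ := ih v (fun i hi => hu1 (i + 1) (by omega)) hu
    rw [odometer_wcons_true, kappa_wcons_false hα0 hα1, kappa_wcons_true hα0 hα1, h3]
    have h1' := mul_le_mul_of_nonneg_left h1 hα0.le
    have h2' := mul_le_mul_of_nonneg_left h2 hα0.le
    refine ⟨⟨?_, ?_⟩, by ring⟩
    · rw [pow_succ]; linarith
    · rw [pow_succ α (j + 1), pow_succ α j] at *; linarith

theorem f_kappa (hα0 : 0 < α) (hα1 : α < 1 / 2) (u : ℕ → Bool) :
    f α (kappa α u) = kappa α (odometer u) := by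
  by_cases h : ∃ j, u j = false
  · classical
    obtain ⟨h1, h2⟩ := kappa_mem_Icc_and_kappa_odometer hα0 hα1 (Nat.find h) u
      (fun i hi => by simpa using Nat.find_min h hi) (Nat.find_spec h)
    rw [f_of_mem_Icc hα0 hα1 h1, h2]
  · obtain rfl : u = fun _ => true := by
      ext n
      simpa using fun h0 => h ⟨n, h0⟩
    have : odometer (fun _ => true) = fun _ => false := by ext n; simp [odometer]
    rw [this, kappa_const_true hα0 hα1, kappa_const_false, f_one hα0 hα1]

theorem iterate_f_kappa (hα0 : 0 < α) (hα1 : α < 1 / 2) (n : ℕ) (u : ℕ → Bool) :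
    (f α)^[n] (kappa α u) = kappa α (odometer^[n] u) :=
  ((Function.Semiconj.iterate_right (f := kappa α) (fun v => (f_kappa hα0 hα1 v).symm) n).eq
    u).symm

theorem measurePreserving_kappa (hα0 : 0 < α) (hα1 : α < 1 / 2) :
    MeasurePreserving (kappa α) coin (mu α) :=
  ⟨measurable_kappa hα0 hα1, rfl⟩

theorem isProbabilityMeasure_mu (hα0 : 0 < α) (hα1 : α < 1 / 2) :
    IsProbabilityMeasure (mu α) :=
  Measure.isProbabilityMeasure_map (measurable_kappa hα0 hα1).aemeasurable

theorem mu_compl_Icc (hα0 : 0 < α) (hα1 : α < 1 / 2) : mu α (Icc 0 1)ᶜ = 0 := by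
  rw [mu, Measure.map_apply (measurable_kappa hα0 hα1) measurableSet_Icc.compl]
  have : kappa α ⁻¹' (Icc 0 1)ᶜ = ∅ :=
    eq_empty_of_forall_notMem fun u hu => hu ⟨kappa_nonneg hα0 hα1 u, kappa_le_one hα0 hα1 u⟩
  simp [this]

theorem ergodic_f (hα0 : 0 < α) (hα1 : α < 1 / 2) : Ergodic (f α) (mu α) :=
  (measurePreserving_kappa hα0 hα1).ergodic_of_ergodic_semiconj ergodic_odometer
    (measurable_f hα0 hα1) fun u => (f_kappa hα0 hα1 u).symm

/-! ### The distribution function of `μ_α` -/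

/-- The self-similarity equation of the distribution function of `μ_α`, with the boundary values
of the distribution function of a measure on `[0, 1]` without atom at `0`. -/
structure IsSelfSimilarCdf (α : ℝ) (Φ : ℝ → ℝ) : Prop where
  nonneg : ∀ t, 0 ≤ Φ t
  le_one : ∀ t, Φ t ≤ 1
  eq_zero : ∀ t < 0, Φ t = 0
  eq_one : ∀ t, 1 ≤ t → Φ t = 1
  eq_half : ∀ t, Φ t = (Φ (t / α) + Φ ((t - (1 - α)) / α)) / 2

/-- The self-similarity equation has a unique solution: since `α < 1 - α`, two solutions agree on
one of the two terms of the right-hand side, so that their distance halves. -/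
theorem IsSelfSimilarCdf.unique (hα0 : 0 < α) (hα1 : α < 1 / 2) {Φ Ψ : ℝ → ℝ}
    (hΦ : IsSelfSimilarCdf α Φ) (hΨ : IsSelfSimilarCdf α Ψ) (t : ℝ) : Φ t = Ψ t := by
  have key : ∀ n : ℕ, ∀ t, |Φ t - Ψ t| ≤ (1 / 2) ^ n := by
    intro n
    induction n with
    | zero =>
      intro t
      rw [pow_zero, abs_le]
      constructor <;> linarith [hΦ.nonneg t, hΦ.le_one t, hΨ.nonneg t, hΨ.le_one t]
    | succ n ih =>
      intro t
      rw [hΦ.eq_half t, hΨ.eq_half t]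
      have h1 := abs_le.1 (ih (t / α))
      have h2 := abs_le.1 (ih ((t - (1 - α)) / α))
      rw [pow_succ, abs_le]
      rcases lt_or_ge t (1 - α) with h | h
      · have h3 : (t - (1 - α)) / α < 0 := div_neg_of_neg_of_pos (by linarith) hα0
        rw [hΦ.eq_zero _ h3, hΨ.eq_zero _ h3]
        constructor <;> linarith [h1.1, h1.2]
      · have h3 : 1 ≤ t / α := (one_le_div hα0).2 (by linarith)
        rw [hΦ.eq_one _ h3, hΨ.eq_one _ h3]
        constructor <;> linarith [h2.1, h2.2]
  exact sub_eq_zero.1 (abs_nonpos_iff.1 (ge_of_tendsto'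
    (tendsto_pow_atTop_nhds_zero_of_lt_one (by norm_num) (by norm_num)) fun n => key n t))

/-- The distribution function of `μ_α`. -/
noncomputable def cdf (α t : ℝ) : ℝ := coin.real {u | kappa α u ≤ t}

theorem cdf_mono (α : ℝ) : Monotone (cdf α) := fun _ _ h =>
  measureReal_mono fun _ hu => le_trans hu h

theorem isSelfSimilarCdf_cdf (hα0 : 0 < α) (hα1 : α < 1 / 2) : IsSelfSimilarCdf α (cdf α) where
  nonneg _ := measureReal_nonneg
  le_one _ := measureReal_le_one
  eq_zero t ht := by
    have : {u | kappa α u ≤ t} = ∅ := eq_empty_of_forall_notMem fun u (hu : kappa α u ≤ t) => by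
      linarith [kappa_nonneg hα0 hα1 u]
    simp [cdf, this]
  eq_one t ht := by
    have : {u | kappa α u ≤ t} = univ := eq_univ_of_forall fun u =>
      (kappa_le_one hα0 hα1 u).trans ht
    simp [cdf, this]
  eq_half t := by
    unfold cdf
    rw [coin_real_eq _ (measurableSet_le (measurable_kappa hα0 hα1) measurable_const)]
    simp only [preimage_ofPred_eq, kappa_wcons_false hα0 hα1, kappa_wcons_true hα0 hα1,
      le_div_iff₀' hα0, le_sub_iff_add_le']

theorem cdf_zero (hα0 : 0 < α) (hα1 : α < 1 / 2) : cdf α 0 = 0 := by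
  have hF := isSelfSimilarCdf_cdf hα0 hα1
  have h := hF.eq_half 0
  rw [zero_div, hF.eq_zero ((0 - (1 - α)) / α) (div_neg_of_neg_of_pos (by linarith) hα0)] at h
  linarith

theorem cdf_of_nonpos (hα0 : 0 < α) (hα1 : α < 1 / 2) {t : ℝ} (ht : t ≤ 0) : cdf α t = 0 :=
  le_antisymm ((cdf_mono α ht).trans_eq (cdf_zero hα0 hα1))
    ((isSelfSimilarCdf_cdf hα0 hα1).nonneg t)

theorem cdf_one_sub (hα0 : 0 < α) (hα1 : α < 1 / 2) (t : ℝ) : cdf α (1 - t) = 1 - cdf α t := by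
  have hF := isSelfSimilarCdf_cdf hα0 hα1
  have h : IsSelfSimilarCdf α fun t => 1 - cdf α (1 - t) := by
    refine ⟨fun t => by linarith [hF.le_one (1 - t)], fun t => by linarith [hF.nonneg (1 - t)],
      fun t ht => by rw [hF.eq_one _ (by linarith)]; ring,
      fun t ht => by rw [cdf_of_nonpos hα0 hα1 (by linarith)]; ring, fun t => ?_⟩
    rw [hF.eq_half]
    have h1 : (1 - t) / α = 1 - (t - (1 - α)) / α := by field_simp; ring
    have h2 : (1 - t - (1 - α)) / α = 1 - t / α := by field_simp; ring
    rw [h1, h2]; ring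
  linarith [hF.unique hα0 hα1 h t]

theorem cdf_eq_lt (hα0 : 0 < α) (hα1 : α < 1 / 2) (t : ℝ) :
    cdf α t = coin.real {u | kappa α u < t} := by
  refine (isSelfSimilarCdf_cdf hα0 hα1).unique hα0 hα1 (Ψ := fun t => coin.real {u | kappa α u < t})
    ?_ t
  have hhalf (t : ℝ) : coin.real {u | kappa α u < t} = (coin.real {u | kappa α u < t / α} +
      coin.real {u | kappa α u < (t - (1 - α)) / α}) / 2 := by
    rw [coin_real_eq _ (measurableSet_lt (measurable_kappa hα0 hα1) measurable_const)]
    simp only [preimage_ofPred_eq, kappa_wcons_false hα0 hα1, kappa_wcons_true hα0 hα1,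
      lt_div_iff₀' hα0, lt_sub_iff_add_lt']
  have hone (t : ℝ) (ht : 1 < t) : coin.real {u | kappa α u < t} = 1 := by
    have : {u | kappa α u < t} = univ := eq_univ_of_forall fun u =>
      (kappa_le_one hα0 hα1 u).trans_lt ht
    simp [this]
  refine ⟨fun _ => measureReal_nonneg, fun _ => measureReal_le_one, fun t ht => ?_,
    fun t ht => ?_, hhalf⟩
  · have : {u | kappa α u < t} = ∅ := eq_empty_of_forall_notMem fun u (hu : kappa α u < t) => by
      linarith [kappa_nonneg hα0 hα1 u]
    simp [this]
  · rcases ht.eq_or_lt with rfl | ht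
    · have h := hhalf 1
      rw [hone (1 / α) ((one_lt_div hα0).2 (by linarith)), sub_sub_cancel, div_self hα0.ne'] at h
      linarith
    · exact hone t ht

theorem coin_kappa_eq (hα0 : 0 < α) (hα1 : α < 1 / 2) (t : ℝ) :
    coin {u | kappa α u = t} = 0 := by
  have hm := measurable_kappa hα0 hα1
  have h : coin.real {u | kappa α u ≤ t} =
      coin.real {u | kappa α u < t} + coin.real {u | kappa α u = t} := by
    rw [← measureReal_union _ (measurableSet_eq_fun hm measurable_const)]
    · congr 1; ext u; exact le_iff_lt_or_eq (a := kappa α u)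
    · exact disjoint_left.2 fun u (h1 : kappa α u < t) (h2 : kappa α u = t) => h1.ne h2
  have h2 := cdf_eq_lt hα0 hα1 t
  rw [cdf] at h2
  have h3 : coin.real {u | kappa α u = t} = 0 := by linarith
  exact (measureReal_eq_zero_iff).1 h3

theorem mu_singleton (hα0 : 0 < α) (hα1 : α < 1 / 2) (x : ℝ) : mu α {x} = 0 := by
  rw [mu, Measure.map_apply (measurable_kappa hα0 hα1) (measurableSet_singleton x)]
  exact coin_kappa_eq hα0 hα1 x

theorem cdf_mul (hα0 : 0 < α) (hα1 : α < 1 / 2) {t : ℝ} (ht : t ≤ 1) :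
    cdf α (α * t) = cdf α t / 2 := by
  have hF := isSelfSimilarCdf_cdf hα0 hα1
  rw [hF.eq_half, mul_div_cancel_left₀ _ hα0.ne',
    hF.eq_zero ((α * t - (1 - α)) / α) (div_neg_of_neg_of_pos (by nlinarith) hα0), add_zero]

theorem cdf_pow_mul (hα0 : 0 < α) (hα1 : α < 1 / 2) {t : ℝ} (ht0 : 0 ≤ t) (ht : t ≤ 1) (n : ℕ) :
    cdf α (α ^ n * t) = cdf α t / 2 ^ n := by
  induction n with
  | zero => simp
  | succ n ih =>
    rw [pow_succ', mul_assoc, cdf_mul hα0 hα1, ih, pow_succ]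
    · field_simp
    · exact mul_le_one₀ (pow_le_one₀ hα0.le (by linarith)) ht0 ht

theorem cdf_pos (hα0 : 0 < α) (hα1 : α < 1 / 2) {t : ℝ} (ht : 0 < t) : 0 < cdf α t := by
  obtain ⟨n, hn⟩ := exists_pow_lt_of_lt_one ht (show α < 1 by linarith)
  refine lt_of_lt_of_le ?_ (cdf_mono α hn.le)
  have := cdf_pow_mul hα0 hα1 zero_le_one le_rfl n
  rw [mul_one, (isSelfSimilarCdf_cdf hα0 hα1).eq_one 1 le_rfl] at this
  rw [this]; positivity

/-- Subadditivity of the distribution function, up to an error that halves at every step. The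
first estimate follows from both estimates at the finer scale, and so does the second one, which is
superadditivity up to a shift by the length `1 - 2α` of the central gap. -/
theorem cdf_subadditive_aux (hα0 : 0 < α) (hα1 : α < 1 / 2) (n : ℕ) :
    (∀ x y, 0 ≤ x → 0 ≤ y → cdf α (x + y) ≤ cdf α x + cdf α y + (1 / 2) ^ n) ∧
    (∀ p q, 0 ≤ p → 0 ≤ q → p + q ≤ 1 →
      cdf α p + cdf α q ≤ cdf α (p + q + (1 - 2 * α)) + (1 / 2) ^ n) := by
  have hF := isSelfSimilarCdf_cdf hα0 hα1
  have hmono := cdf_mono α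
  have hsymm := cdf_one_sub hα0 hα1
  induction n with
  | zero =>
    refine ⟨fun x y _ _ => ?_, fun p q _ _ hpq => ?_⟩
    · linarith [hF.le_one (x + y), hF.nonneg x, hF.nonneg y]
    · have := hmono (show p ≤ 1 - q by linarith)
      rw [hsymm] at this
      linarith [hF.nonneg (p + q + (1 - 2 * α))]
  | succ n ih =>
    obtain ⟨ihA, ihB⟩ := ih
    set e : ℝ := (1 / 2) ^ n
    have he : (1 / 2 : ℝ) ^ (n + 1) = e / 2 := by rw [pow_succ]; ring
    have he0 : 0 ≤ e := by positivity
    rw [he]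
    have hbig (t : ℝ) (ht : α ≤ t) : cdf α (t / α) = 1 := hF.eq_one _ ((one_le_div hα0).2 ht)
    have hsmall (t : ℝ) (ht : t < 1 - α) : cdf α ((t - (1 - α)) / α) = 0 :=
      hF.eq_zero _ (div_neg_of_neg_of_pos (by linarith) hα0)
    have hn1 (t : ℝ) := hF.nonneg (t / α)
    have hn2 (t : ℝ) := hF.nonneg ((t - (1 - α)) / α)
    constructor
    · intro x y hx hy
      have hlarge : ∀ x y, 0 ≤ y → 1 - α ≤ x → cdf α (x + y) ≤ cdf α x + cdf α y + e / 2 := by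
        intro x y hy hx
        rw [hF.eq_half (x + y), hF.eq_half x, hF.eq_half y, hbig x (by linarith),
          hbig (x + y) (by linarith)]
        have := ihA ((x - (1 - α)) / α) (y / α) (div_nonneg (by linarith) hα0.le) (by positivity)
        rw [← add_div, sub_add_eq_add_sub] at this
        linarith [hn2 y]
      rcases le_or_gt (1 - α) x with hx1 | hx1
      · exact hlarge x y hy hx1
      rcases le_or_gt (1 - α) y with hy1 | hy1
      · rw [add_comm x, add_comm (cdf α x)]
        exact hlarge y x hx hy1
      rw [hF.eq_half (x + y), hF.eq_half x, hF.eq_half y, hsmall x hx1, hsmall y hy1]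
      rcases lt_or_ge (x + y) (1 - α) with hxy | hxy
      · rw [hsmall _ hxy]
        have := ihA (x / α) (y / α) (by positivity) (by positivity)
        rw [← add_div] at this
        linarith
      rw [hbig (x + y) (by linarith)]
      rcases le_or_gt α x with hx2 | hx2
      · rw [hbig x hx2]
        have := hmono (show (x + y - (1 - α)) / α ≤ y / α by gcongr; linarith)
        linarith
      rcases le_or_gt α y with hy2 | hy2
      · rw [hbig y hy2]
        have := hmono (show (x + y - (1 - α)) / α ≤ x / α by gcongr; linarith)
        linarith
      have hx3 : x / α < 1 := (div_lt_one hα0).2 hx2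
      have hy3 : y / α < 1 := (div_lt_one hα0).2 hy2
      have hxy3 : 1 ≤ x / α + y / α := by
        rw [← add_div]; exact (one_le_div hα0).2 (by linarith)
      have hB := ihB (1 - x / α) (1 - y / α) (by linarith) (by linarith) (by linarith)
      rw [show 1 - x / α + (1 - y / α) + (1 - 2 * α) = 1 - (x / α + y / α - (2 - 2 * α)) by ring,
        hsymm, hsymm, hsymm] at hB
      have hle : (x + y - (1 - α)) / α ≤ x / α + y / α - (2 - 2 * α) := by
        have h2 : 2 - 2 * α ≤ (1 - α) / α := (le_div_iff₀ hα0).2 (by nlinarith)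
        rw [sub_div, add_div]
        linarith
      linarith [hmono hle]
    · have main : ∀ p q, 0 ≤ p → p ≤ q → p + q ≤ 1 →
          cdf α p + cdf α q ≤ cdf α (p + q + (1 - 2 * α)) + e / 2 := by
        intro p q hp hpq h1
        have hg : 1 - 2 * α ≤ (1 - 2 * α) / α := (le_div_iff₀ hα0).2 (by nlinarith)
        rw [hF.eq_half p, hF.eq_half q, hF.eq_half (p + q + (1 - 2 * α)), hsmall p (by linarith)]
        rcases le_or_gt (1 - α) q with hq | hq
        · rw [hbig q (by linarith), hbig (p + q + (1 - 2 * α)) (by linarith)]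
          have hB := ihB (p / α) ((q - (1 - α)) / α) (by positivity)
            (div_nonneg (by linarith) hα0.le)
            (by rw [← add_div]; exact (div_le_one hα0).2 (by linarith))
          have hle : p / α + (q - (1 - α)) / α + (1 - 2 * α) ≤
              (p + q + (1 - 2 * α) - (1 - α)) / α := by
            refine (add_le_add_right hg _).trans_eq ?_
            ring
          linarith [hmono hle]
        rw [hsmall q hq]
        rcases le_or_gt (p + q) α with hpq1 | hpq1
        · have hB := ihB (p / α) (q / α) (by positivity) (div_nonneg (by linarith) hα0.le)
            (by rw [← add_div]; exact (div_le_one hα0).2 hpq1)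
          have hle : p / α + q / α + (1 - 2 * α) ≤ (p + q + (1 - 2 * α)) / α := by
            refine (add_le_add_right hg _).trans_eq ?_
            ring
          linarith [hmono hle, hn2 (p + q + (1 - 2 * α))]
        rw [hbig (p + q + (1 - 2 * α)) (by linarith)]
        have hz : (p + q + (1 - 2 * α) - (1 - α)) / α = p / α + q / α - 1 := by
          field_simp; ring
        rw [hz]
        rcases le_or_gt α q with hq2 | hq2
        · rw [hbig q hq2]
          have := (one_le_div hα0).2 hq2
          linarith [hmono (show p / α ≤ p / α + q / α - 1 by linarith)]
        · have hp3 : p / α < 1 := (div_lt_one hα0).2 (by linarith)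
          have hpq3 : 1 < p / α + q / α := by rw [← add_div]; exact (one_lt_div hα0).2 hpq1
          have hA := ihA (1 - p / α) (p / α + q / α - 1) (by linarith) (by linarith)
          rw [hsymm, show 1 - p / α + (p / α + q / α - 1) = q / α by ring] at hA
          linarith
      intro p q hp hq h1
      rcases le_total p q with h | h
      · exact main p q hp h h1
      · rw [add_comm (cdf α p), add_comm p]
        exact main q p hq h (by linarith)

/-- Among all intervals of a given length, the one starting at `0` has the largest mass. -/
theorem cdf_sub_le (hα0 : 0 < α) (hα1 : α < 1 / 2) {x y : ℝ} (hy : 0 ≤ y) :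
    cdf α (x + y) - cdf α x ≤ cdf α y := by
  rcases le_or_gt 0 x with hx | hx
  · have h := ge_of_tendsto' (tendsto_pow_atTop_nhds_zero_of_lt_one
      (show (0 : ℝ) ≤ 1 / 2 by norm_num) (by norm_num))
      fun n => sub_le_iff_le_add'.2 ((cdf_subadditive_aux hα0 hα1 n).1 x y hx hy)
    linarith
  · linarith [cdf_mono α (show x + y ≤ y by linarith), (isSelfSimilarCdf_cdf hα0 hα1).nonneg x]

/-! ### The first correlation integral -/

/-- The first correlation integral of `μ_α`, on the coding space. -/
noncomputable def corrOne (α ε : ℝ) : ℝ := coin2.real {p | |kappa α p.1 - kappa α p.2| ≤ ε}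

/-- The distribution function of the difference of two independent points with law `μ_α`. -/
noncomputable def diffCdf (α t : ℝ) : ℝ := coin2.real {p | kappa α p.1 - kappa α p.2 ≤ t}

theorem measurable_kappa_sub (hα0 : 0 < α) (hα1 : α < 1 / 2) :
    Measurable fun p : (ℕ → Bool) × (ℕ → Bool) => kappa α p.1 - kappa α p.2 :=
  ((measurable_kappa hα0 hα1).comp measurable_fst).sub
    ((measurable_kappa hα0 hα1).comp measurable_snd)

theorem corrOne_mono (α : ℝ) : Monotone (corrOne α) := fun _ _ h =>
  measureReal_mono fun _ hp => le_trans hp h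

theorem diffCdf_mono (α : ℝ) : Monotone (diffCdf α) := fun _ _ h =>
  measureReal_mono fun _ hp => le_trans hp h

theorem corrOne_le_one (α t : ℝ) : corrOne α t ≤ 1 := measureReal_le_one

theorem diffCdf_nonneg (α t : ℝ) : 0 ≤ diffCdf α t := measureReal_nonneg

theorem abs_kappa_sub_le (hα0 : 0 < α) (hα1 : α < 1 / 2) (u v : ℕ → Bool) :
    |kappa α u - kappa α v| ≤ 1 := by
  rw [abs_le]
  constructor <;> linarith [kappa_nonneg hα0 hα1 u, kappa_le_one hα0 hα1 u,
    kappa_nonneg hα0 hα1 v, kappa_le_one hα0 hα1 v]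

theorem corrOne_of_one_le (hα0 : 0 < α) (hα1 : α < 1 / 2) {ε : ℝ} (hε : 1 ≤ ε) :
    corrOne α ε = 1 := by
  have : {p : (ℕ → Bool) × (ℕ → Bool) | |kappa α p.1 - kappa α p.2| ≤ ε} = univ :=
    eq_univ_of_forall fun p => (abs_kappa_sub_le hα0 hα1 _ _).trans hε
  simp [corrOne, this]

theorem diffCdf_of_one_le (hα0 : 0 < α) (hα1 : α < 1 / 2) {t : ℝ} (ht : 1 ≤ t) :
    diffCdf α t = 1 := by
  have : {p : (ℕ → Bool) × (ℕ → Bool) | kappa α p.1 - kappa α p.2 ≤ t} = univ :=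
    eq_univ_of_forall fun p => (abs_le.1 (abs_kappa_sub_le hα0 hα1 _ _)).2.trans ht
  rw [diffCdf, this, probReal_univ]

theorem diffCdf_swap (hα0 : 0 < α) (hα1 : α < 1 / 2) (t : ℝ) :
    coin2.real {p | kappa α p.2 - kappa α p.1 ≤ t} = diffCdf α t :=
  (Measure.measurePreserving_swap (μ := coin) (ν := coin)).measureReal_preimage
    (measurableSet_le (measurable_kappa_sub hα0 hα1) measurable_const).nullMeasurableSet

theorem coin2_kappa_sub_eq (hα0 : 0 < α) (hα1 : α < 1 / 2) (t : ℝ) :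
    coin2 {p | kappa α p.1 - kappa α p.2 = t} = 0 := by
  rw [Measure.measure_prod_null
    (measurableSet_eq_fun (measurable_kappa_sub hα0 hα1) measurable_const)]
  refine Filter.Eventually.of_forall fun u => ?_
  have : Prod.mk u ⁻¹' {p : (ℕ → Bool) × (ℕ → Bool) | kappa α p.1 - kappa α p.2 = t} =
      {v | kappa α v = kappa α u - t} := by
    ext v
    change kappa α u - kappa α v = t ↔ kappa α v = kappa α u - t
    constructor <;> intro h <;> linarith
  change coin (Prod.mk u ⁻¹' _) = 0
  rw [this]
  exact coin_kappa_eq hα0 hα1 _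

theorem diffCdf_neg (hα0 : 0 < α) (hα1 : α < 1 / 2) (t : ℝ) :
    diffCdf α (-t) = 1 - diffCdf α t := by
  have hm := measurable_kappa_sub hα0 hα1
  rw [← diffCdf_swap hα0 hα1 (-t), diffCdf,
    ← probReal_compl_eq_one_sub (measurableSet_le hm measurable_const)]
  refine measureReal_congr ?_
  have h0 : ∀ᵐ p ∂coin2, kappa α p.1 - kappa α p.2 ≠ t := by
    rw [ae_iff]
    simpa only [ne_eq, not_not] using coin2_kappa_sub_eq hα0 hα1 t
  filter_upwards [h0] with p hp
  refine propext (?_ : kappa α p.2 - kappa α p.1 ≤ -t ↔ ¬ (kappa α p.1 - kappa α p.2 ≤ t))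
  rw [not_le]
  exact ⟨fun h => lt_of_le_of_ne (by linarith) hp.symm, fun h => by linarith⟩

theorem diffCdf_of_le_neg_one (hα0 : 0 < α) (hα1 : α < 1 / 2) {t : ℝ} (ht : t ≤ -1) :
    diffCdf α t = 0 := by
  have := diffCdf_neg hα0 hα1 (-t)
  rw [neg_neg, diffCdf_of_one_le hα0 hα1 (t := -t) (by linarith)] at this
  rw [this, sub_self]

theorem diffCdf_of_nonneg (hα0 : 0 < α) (hα1 : α < 1 / 2) {t : ℝ} (ht : 0 ≤ t) :
    diffCdf α t = (1 + corrOne α t) / 2 := by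
  have hm := measurable_kappa_sub hα0 hα1
  have hm1 : MeasurableSet {p : (ℕ → Bool) × (ℕ → Bool) | kappa α p.2 - kappa α p.1 ≤ t} :=
    measurableSet_le (hm.comp measurable_swap) measurable_const
  have h := measureReal_union_add_inter (μ := coin2)
    (s := {p : (ℕ → Bool) × (ℕ → Bool) | kappa α p.1 - kappa α p.2 ≤ t}) hm1
  have hu : {p : (ℕ → Bool) × (ℕ → Bool) | kappa α p.1 - kappa α p.2 ≤ t} ∪
      {p | kappa α p.2 - kappa α p.1 ≤ t} = univ := by
    refine eq_univ_of_forall fun p => ?_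
    change kappa α p.1 - kappa α p.2 ≤ t ∨ kappa α p.2 - kappa α p.1 ≤ t
    rcases le_total (kappa α p.1) (kappa α p.2) with h | h
    · left; linarith
    · right; linarith
  have hi : {p : (ℕ → Bool) × (ℕ → Bool) | kappa α p.1 - kappa α p.2 ≤ t} ∩
      {p | kappa α p.2 - kappa α p.1 ≤ t} = {p | |kappa α p.1 - kappa α p.2| ≤ t} := by
    ext p
    change (kappa α p.1 - kappa α p.2 ≤ t ∧ kappa α p.2 - kappa α p.1 ≤ t) ↔
      |kappa α p.1 - kappa α p.2| ≤ t
    rw [abs_le']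
    simp
  rw [hu, hi, diffCdf_swap hα0 hα1, probReal_univ] at h
  unfold corrOne
  unfold diffCdf at h ⊢
  linarith

theorem corrOne_zero (hα0 : 0 < α) (hα1 : α < 1 / 2) : corrOne α 0 = 0 := by
  have h := diffCdf_neg hα0 hα1 0
  rw [neg_zero, diffCdf_of_nonneg hα0 hα1 le_rfl] at h
  linarith

/-- Self-similarity of the first correlation integral, by the first letters of the two words. -/
theorem corrOne_eq_half (hα0 : 0 < α) (hα1 : α < 1 / 2) (ε : ℝ) :
    corrOne α ε = (corrOne α (ε / α) + diffCdf α ((ε - (1 - α)) / α)) / 2 := by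
  have hm := measurable_kappa_sub hα0 hα1
  have hD (p : (ℕ → Bool) × (ℕ → Bool)) := abs_le.1 (abs_kappa_sub_le hα0 hα1 p.1 p.2)
  have hsame (p : (ℕ → Bool) × (ℕ → Bool)) :
      |α * kappa α p.1 - α * kappa α p.2| ≤ ε ↔ |kappa α p.1 - kappa α p.2| ≤ ε / α := by
    rw [← mul_sub, abs_mul, abs_of_pos hα0, le_div_iff₀' hα0]
  have htt (p : (ℕ → Bool) × (ℕ → Bool)) :
      |1 - α + α * kappa α p.1 - (1 - α + α * kappa α p.2)| ≤ ε ↔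
        |kappa α p.1 - kappa α p.2| ≤ ε / α := by
    rw [← hsame]; ring_nf
  have htf (p : (ℕ → Bool) × (ℕ → Bool)) :
      |1 - α + α * kappa α p.1 - α * kappa α p.2| ≤ ε ↔
        kappa α p.1 - kappa α p.2 ≤ (ε - (1 - α)) / α := by
    rw [abs_of_nonneg (by nlinarith [hD p]), le_div_iff₀' hα0]
    constructor <;> intro h <;> linarith
  have hft (p : (ℕ → Bool) × (ℕ → Bool)) :
      |α * kappa α p.1 - (1 - α + α * kappa α p.2)| ≤ ε ↔
        kappa α p.2 - kappa α p.1 ≤ (ε - (1 - α)) / α := by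
    rw [abs_sub_comm]; exact htf p.swap
  have key := coin2_real_eq {p | |kappa α p.1 - kappa α p.2| ≤ ε}
    (measurableSet_le hm.abs measurable_const)
  simp only [mem_ofPred_eq, kappa_wcons_false hα0 hα1, kappa_wcons_true hα0 hα1, hsame, htt, htf,
    hft] at key
  rw [diffCdf_swap hα0 hα1] at key
  unfold corrOne
  unfold diffCdf at key ⊢
  rw [key]; ring

theorem corrOne_mul (hα0 : 0 < α) (hα1 : α < 1 / 2) (ε : ℝ) :
    corrOne α (α * ε) = (corrOne α ε + diffCdf α (ε - (1 - α) / α)) / 2 := by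
  rw [corrOne_eq_half hα0 hα1, mul_div_cancel_left₀ _ hα0.ne', sub_div,
    mul_div_cancel_left₀ _ hα0.ne']

theorem corrOne_div_two_pow_le (hα0 : 0 < α) (hα1 : α < 1 / 2) (ε : ℝ) (n : ℕ) :
    corrOne α ε / 2 ^ n ≤ corrOne α (α ^ n * ε) := by
  induction n with
  | zero => simp
  | succ n ih =>
    rw [pow_succ' α, mul_assoc, corrOne_mul hα0 hα1, pow_succ, ← div_div]
    linarith [diffCdf_nonneg α (α ^ n * ε - (1 - α) / α)]

theorem corrOne_pos (hα0 : 0 < α) (hα1 : α < 1 / 2) {ε : ℝ} (hε : 0 < ε) : 0 < corrOne α ε := by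
  obtain ⟨n, hn⟩ := exists_pow_lt_of_lt_one hε (show α < 1 by linarith)
  refine lt_of_lt_of_le ?_ (corrOne_mono α hn.le)
  have := corrOne_div_two_pow_le hα0 hα1 1 n
  rw [mul_one, corrOne_of_one_le hα0 hα1 le_rfl] at this
  exact lt_of_lt_of_le (by positivity) this

theorem corrOne_mul_strict (hα0 : 0 < α) (hα1 : α < 1 / 2) {a b : ℝ} (hab : a ≤ b)
    (h : corrOne α a < corrOne α b) (n : ℕ) : corrOne α (α ^ n * a) < corrOne α (α ^ n * b) := by
  induction n with
  | zero => simpa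
  | succ n ih =>
    rw [pow_succ', mul_assoc, mul_assoc, corrOne_mul hα0 hα1,
      corrOne_mul hα0 hα1]
    have := diffCdf_mono α (show α ^ n * a - (1 - α) / α ≤ α ^ n * b - (1 - α) / α by gcongr)
    linarith

/-- The increments of the first correlation integral are controlled by those at `0` of the
distribution function of `μ_α`: condition on one of the two points. -/
theorem corrOne_sub_le (hα0 : 0 < α) (hα1 : α < 1 / 2) {a b : ℝ} (ha : 0 ≤ a) (hab : a ≤ b) :
    corrOne α b - corrOne α a ≤ 2 * cdf α (b - a) := by
  have hm := measurable_kappa_sub hα0 hα1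
  have hκ := measurable_kappa hα0 hα1
  have hmeas : MeasurableSet {p : (ℕ → Bool) × (ℕ → Bool) |
      a < kappa α p.1 - kappa α p.2 ∧ kappa α p.1 - kappa α p.2 ≤ b} :=
    (measurableSet_lt measurable_const hm).inter (measurableSet_le hm measurable_const)
  have hsub : diffCdf α b - diffCdf α a =
      coin2.real {p | a < kappa α p.1 - kappa α p.2 ∧ kappa α p.1 - kappa α p.2 ≤ b} := by
    unfold diffCdf
    rw [sub_eq_iff_eq_add', ← measureReal_union _ hmeas]
    · congr 1
      ext p
      change kappa α p.1 - kappa α p.2 ≤ b ↔ (kappa α p.1 - kappa α p.2 ≤ a) ∨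
        (a < kappa α p.1 - kappa α p.2 ∧ kappa α p.1 - kappa α p.2 ≤ b)
      refine ⟨fun h => (le_or_gt _ a).imp_right fun h' => ⟨h', h⟩, ?_⟩
      rintro (h | h)
      · exact h.trans hab
      · exact h.2
    · refine disjoint_left.2 fun p (h1 : kappa α p.1 - kappa α p.2 ≤ a) h2 => ?_
      exact absurd h2.1 (not_lt.2 h1)
  have hle : coin2.real {p | a < kappa α p.1 - kappa α p.2 ∧ kappa α p.1 - kappa α p.2 ≤ b} ≤
      cdf α (b - a) := by
    rw [Measure.real, Measure.prod_apply_symm hmeas]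
    refine ENNReal.toReal_le_of_le_ofReal measureReal_nonneg ?_
    calc _ ≤ ∫⁻ _, ENNReal.ofReal (cdf α (b - a)) ∂coin := by
          refine lintegral_mono fun v => ?_
          have hs : (fun u => (u, v)) ⁻¹' {p : (ℕ → Bool) × (ℕ → Bool) |
              a < kappa α p.1 - kappa α p.2 ∧ kappa α p.1 - kappa α p.2 ≤ b} =
              {u | kappa α u ≤ kappa α v + a + (b - a)} \ {u | kappa α u ≤ kappa α v + a} := by
            ext u
            change (a < kappa α u - kappa α v ∧ kappa α u - kappa α v ≤ b) ↔
              (kappa α u ≤ kappa α v + a + (b - a) ∧ ¬ (kappa α u ≤ kappa α v + a))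
            rw [not_le]
            constructor <;> rintro ⟨h1, h2⟩ <;> constructor <;> linarith
          beta_reduce
          rw [hs]
          refine (ENNReal.le_ofReal_iff_toReal_le (measure_ne_top _ _) measureReal_nonneg).2 ?_
          refine le_trans (le_of_eq ?_)
            (cdf_sub_le hα0 hα1 (x := kappa α v + a) (sub_nonneg.2 hab))
          refine measureReal_sdiff (μ := coin) (fun u (hu : kappa α u ≤ kappa α v + a) => ?_)
            (measurableSet_le hκ measurable_const)
          exact hu.trans (by linarith)
      _ = ENNReal.ofReal (cdf α (b - a)) := by simp
  have h1 := diffCdf_of_nonneg hα0 hα1 ha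
  have h2 := diffCdf_of_nonneg hα0 hα1 (ha.trans hab)
  linarith

theorem corrOne_le_two_mul_cdf (hα0 : 0 < α) (hα1 : α < 1 / 2) {ε : ℝ} (hε : 0 ≤ ε) :
    corrOne α ε ≤ 2 * cdf α ε := by
  have := corrOne_sub_le hα0 hα1 le_rfl hε
  rwa [corrOne_zero hα0 hα1, sub_zero, sub_zero] at this

theorem one_sub_corrOne_le (hα0 : 0 < α) (hα1 : α < 1 / 2) (t : ℝ) :
    1 - corrOne α t ≤ 2 * (1 - cdf α t) := by
  have hκ := measurable_kappa hα0 hα1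
  have hc : coin.real {u | kappa α u ≤ t}ᶜ = 1 - cdf α t :=
    probReal_compl_eq_one_sub (measurableSet_le hκ measurable_const)
  have h1 : coin2.real (Prod.fst ⁻¹' {u | kappa α u ≤ t}ᶜ) = 1 - cdf α t := by
    rw [← hc]
    exact (measurePreserving_fst (μ := coin) (ν := coin)).measureReal_preimage
      (measurableSet_le hκ measurable_const).compl.nullMeasurableSet
  have h2 : coin2.real (Prod.snd ⁻¹' {u | kappa α u ≤ t}ᶜ) = 1 - cdf α t := by
    rw [← hc]
    exact (measurePreserving_snd (μ := coin) (ν := coin)).measureReal_preimage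
      (measurableSet_le hκ measurable_const).compl.nullMeasurableSet
  rw [corrOne, ← probReal_compl_eq_one_sub
    (measurableSet_le (measurable_kappa_sub hα0 hα1).abs measurable_const), two_mul]
  nth_rewrite 1 [← h1]
  rw [← h2]
  refine le_trans (measureReal_mono ?_) (measureReal_union_le _ _)
  intro p (hp : ¬ |kappa α p.1 - kappa α p.2| ≤ t)
  change ¬ kappa α p.1 ≤ t ∨ ¬ kappa α p.2 ≤ t
  by_contra! h
  refine hp (abs_le.2 ⟨?_, ?_⟩) <;>
    linarith [kappa_nonneg hα0 hα1 p.1, kappa_nonneg hα0 hα1 p.2]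

theorem diffCdf_pos (hα0 : 0 < α) (hα1 : α < 1 / 2) {t : ℝ} (ht : -1 < t) :
    0 < diffCdf α t := by
  have hc : coin.real {u | kappa α u < 1 - (t + 1) / 2}ᶜ = cdf α ((t + 1) / 2) := by
    rw [probReal_compl_eq_one_sub (measurableSet_lt (measurable_kappa hα0 hα1) measurable_const),
      ← cdf_eq_lt hα0 hα1, cdf_one_sub hα0 hα1]
    ring
  have hpos := cdf_pos hα0 hα1 (show 0 < (t + 1) / 2 by linarith)
  have hsub : {u | kappa α u ≤ (t + 1) / 2} ×ˢ {u | kappa α u < 1 - (t + 1) / 2}ᶜ ⊆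
      {p | kappa α p.1 - kappa α p.2 ≤ t} := by
    rintro p ⟨h1 : kappa α p.1 ≤ (t + 1) / 2, h2 : ¬ kappa α p.2 < 1 - (t + 1) / 2⟩
    change kappa α p.1 - kappa α p.2 ≤ t
    linarith
  refine lt_of_lt_of_le ?_ (measureReal_mono hsub)
  rw [measureReal_prod_prod, hc]
  exact mul_pos hpos hpos

/-- Two applications of self-similarity near the right end of `[α, 1]`. -/
theorem corrOne_near_one (hα0 : 0 < α) (hα1 : α < 1 / 2) {s : ℝ} (hs : 1 - α ^ 2 ≤ s) :
    corrOne α s = 15 / 16 + corrOne α ((s - (1 - α ^ 2)) / α ^ 2) / 16 := by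
  have ht : 1 - α ≤ (s - (1 - α)) / α := (le_div_iff₀ hα0).2 (by nlinarith)
  have hτ : ((s - (1 - α)) / α - (1 - α)) / α = (s - (1 - α ^ 2)) / α ^ 2 := by
    field_simp; ring
  have hτ0 : 0 ≤ (s - (1 - α ^ 2)) / α ^ 2 := div_nonneg (by linarith) (by positivity)
  rw [corrOne_eq_half hα0 hα1 s,
    corrOne_of_one_le hα0 hα1 ((one_le_div hα0).2 (by nlinarith : α ≤ s)),
    diffCdf_of_nonneg hα0 hα1 (by linarith), corrOne_eq_half hα0 hα1 ((s - (1 - α)) / α),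
    corrOne_of_one_le hα0 hα1 ((one_le_div hα0).2 (by linarith)), hτ,
    diffCdf_of_nonneg hα0 hα1 hτ0]
  ring

theorem corrOne_one_sub_sq (hα0 : 0 < α) (hα1 : α < 1 / 2) :
    corrOne α (1 - α ^ 2) = 15 / 16 := by
  rw [corrOne_near_one hα0 hα1 le_rfl, sub_self, zero_div, corrOne_zero hα0 hα1]
  norm_num

theorem corrOne_lt_of_lt (hα0 : 0 < α) (hα1 : α < 1 / 2) {s : ℝ} (hs : s < 1 - α ^ 2) :
    corrOne α s < corrOne α (1 - α ^ 2) := by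
  -- by monotonicity, `s` may be moved into `[1 - α + α ^ 2, 1 - α ^ 2)`
  refine lt_of_le_of_lt (corrOne_mono α (le_max_left s (1 - α + α ^ 2))) ?_
  set r := max s (1 - α + α ^ 2)
  have hr : r < 1 - α ^ 2 := max_lt hs (by nlinarith)
  have hr' : 1 - α + α ^ 2 ≤ r := le_max_right _ _
  have ht : α ≤ (r - (1 - α)) / α := (le_div_iff₀ hα0).2 (by nlinarith)
  have hneg : ((r - (1 - α)) / α - (1 - α)) / α < 0 := by
    refine div_neg_of_neg_of_pos (sub_neg.2 ((div_lt_iff₀ hα0).2 ?_)) hα0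
    nlinarith
  have h := diffCdf_neg hα0 hα1 (-(((r - (1 - α)) / α - (1 - α)) / α))
  rw [neg_neg, diffCdf_of_nonneg hα0 hα1 (neg_pos.2 hneg).le] at h
  have hpos := corrOne_pos hα0 hα1 (neg_pos.2 hneg)
  rw [corrOne_one_sub_sq hα0 hα1, corrOne_eq_half hα0 hα1 r,
    diffCdf_of_nonneg hα0 hα1 (hα0.le.trans ht), corrOne_eq_half hα0 hα1 ((r - (1 - α)) / α), h]
  linarith [corrOne_le_one α (r / α), corrOne_le_one α ((r - (1 - α)) / α / α)]

/-! ### The correlation integral along orbits -/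

/-- The pairs of words along whose odometer orbits the difference of the codes is at most `t`. -/
def orbitSubLe (α t : ℝ) : Set ((ℕ → Bool) × (ℕ → Bool)) :=
  {p | ∀ n : ℕ, kappa α (odometer^[n] p.1) - kappa α (odometer^[n] p.2) ≤ t}

theorem mem_orbitSubLe {t : ℝ} {u v : ℕ → Bool} : (u, v) ∈ orbitSubLe α t ↔
    ∀ n : ℕ, kappa α (odometer^[n] u) - kappa α (odometer^[n] v) ≤ t := Iff.rfl

theorem measurableSet_orbitSubLe (hα0 : 0 < α) (hα1 : α < 1 / 2) (t : ℝ) :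
    MeasurableSet (orbitSubLe α t) := by
  have h : orbitSubLe α t = ⋂ n : ℕ,
      (fun p : (ℕ → Bool) × (ℕ → Bool) => (odometer^[n] p.1, odometer^[n] p.2)) ⁻¹'
        {p | kappa α p.1 - kappa α p.2 ≤ t} := by
    ext p
    exact (mem_iInter (s := fun n : ℕ =>
      (fun p : (ℕ → Bool) × (ℕ → Bool) => (odometer^[n] p.1, odometer^[n] p.2)) ⁻¹'
        {p | kappa α p.1 - kappa α p.2 ≤ t})).symm
  rw [h]
  refine MeasurableSet.iInter fun n => ?_
  exact (((measurable_odometer.iterate n).comp measurable_fst).prodMk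
    ((measurable_odometer.iterate n).comp measurable_snd))
    (measurableSet_le (measurable_kappa_sub hα0 hα1) measurable_const)

theorem odometer_iterate_even (n : ℕ) (b : Bool) (u : ℕ → Bool) :
    odometer^[2 * n] (wcons b u) = wcons b (odometer^[n] u) := by
  induction n generalizing u with
  | zero => rfl
  | succ n ih =>
    rw [show 2 * (n + 1) = 2 * n + 1 + 1 by ring, Function.iterate_succ_apply,
      Function.iterate_succ_apply, Function.iterate_succ_apply]
    cases b <;> simp [ih]

theorem odometer_iterate_odd_false (n : ℕ) (u : ℕ → Bool) :
    odometer^[2 * n + 1] (wcons false u) = wcons true (odometer^[n] u) := by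
  rw [Function.iterate_succ_apply, odometer_wcons_false, odometer_iterate_even]

theorem odometer_iterate_odd_true (n : ℕ) (u : ℕ → Bool) :
    odometer^[2 * n + 1] (wcons true u) = wcons false (odometer^[n + 1] u) := by
  rw [Function.iterate_succ_apply, odometer_wcons_true, odometer_iterate_even,
    Function.iterate_succ_apply]

theorem forall_nat_iff_even_odd {p : ℕ → Prop} :
    (∀ n, p n) ↔ (∀ n, p (2 * n)) ∧ ∀ n, p (2 * n + 1) := by
  refine ⟨fun h => ⟨fun n => h _, fun n => h _⟩, fun ⟨h0, h1⟩ n => ?_⟩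
  rcases Nat.even_or_odd' n with ⟨k, rfl | rfl⟩
  exacts [h0 k, h1 k]

theorem orbitSubLe_of_one_le (hα0 : 0 < α) (hα1 : α < 1 / 2) {t : ℝ} (ht : 1 ≤ t) :
    orbitSubLe α t = univ :=
  eq_univ_of_forall fun _ _ => (abs_le.1 (abs_kappa_sub_le hα0 hα1 _ _)).2.trans ht

theorem neg_one_le_of_mem_orbitSubLe (hα0 : 0 < α) (hα1 : α < 1 / 2) {t : ℝ}
    {p : (ℕ → Bool) × (ℕ → Bool)} (hp : p ∈ orbitSubLe α t) : -1 ≤ t :=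
  (abs_le.1 (abs_kappa_sub_le hα0 hα1 _ _)).1.trans (hp 0)

theorem false_false_mem_orbitSubLe (hα0 : 0 < α) (hα1 : α < 1 / 2) {t : ℝ} {u v : ℕ → Bool} :
    (wcons false u, wcons false v) ∈ orbitSubLe α t ↔ (u, v) ∈ orbitSubLe α (t / α) := by
  rw [mem_orbitSubLe, mem_orbitSubLe, forall_nat_iff_even_odd]
  simp only [odometer_iterate_even, odometer_iterate_odd_false, kappa_wcons_false hα0 hα1,
    kappa_wcons_true hα0 hα1, le_div_iff₀' hα0, add_sub_add_left_eq_sub, mul_sub, and_self]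

theorem true_true_mem_orbitSubLe (hα0 : 0 < α) (hα1 : α < 1 / 2) {t : ℝ} {u v : ℕ → Bool} :
    (wcons true u, wcons true v) ∈ orbitSubLe α t ↔ (u, v) ∈ orbitSubLe α (t / α) := by
  rw [mem_orbitSubLe, mem_orbitSubLe, forall_nat_iff_even_odd]
  simp only [odometer_iterate_even, odometer_iterate_odd_true, kappa_wcons_false hα0 hα1,
    kappa_wcons_true hα0 hα1, le_div_iff₀' hα0, add_sub_add_left_eq_sub, mul_sub]
  exact ⟨fun h => h.1, fun h => ⟨h, fun n => h (n + 1)⟩⟩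

/-- For words with first letters `1` and `0` the differences at odd times are negative, and only
those at even times matter. -/
theorem true_false_mem_orbitSubLe (hα0 : 0 < α) (hα1 : α < 1 / 2) {t : ℝ} {u v : ℕ → Bool} :
    (wcons true u, wcons false v) ∈ orbitSubLe α t ↔
      (u, v) ∈ orbitSubLe α ((t - (1 - α)) / α) := by
  have hiff (x y : ℝ) : 1 - α + α * x - α * y ≤ t ↔ x - y ≤ (t - (1 - α)) / α := by
    rw [le_div_iff₀' hα0]
    constructor <;> intro h <;> linarith
  rw [mem_orbitSubLe, mem_orbitSubLe, forall_nat_iff_even_odd]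
  simp only [odometer_iterate_even, odometer_iterate_odd_true, odometer_iterate_odd_false,
    kappa_wcons_false hα0 hα1, kappa_wcons_true hα0 hα1, hiff]
  refine ⟨fun h => h.1, fun h => ⟨h, fun n => ?_⟩⟩
  have h1 := neg_one_le_of_mem_orbitSubLe (p := (u, v)) hα0 hα1 h
  rw [le_div_iff₀ hα0] at h1
  nlinarith [kappa_le_one hα0 hα1 (odometer^[n + 1] u), kappa_nonneg hα0 hα1 (odometer^[n] v)]

/-- For words with first letters `0` and `1` only the differences at odd times matter. -/
theorem false_true_mem_orbitSubLe (hα0 : 0 < α) (hα1 : α < 1 / 2) {t : ℝ} {u v : ℕ → Bool} :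
    (wcons false u, wcons true v) ∈ orbitSubLe α t ↔
      (u, odometer v) ∈ orbitSubLe α ((t - (1 - α)) / α) := by
  have hiff (x y : ℝ) : 1 - α + α * x - α * y ≤ t ↔ x - y ≤ (t - (1 - α)) / α := by
    rw [le_div_iff₀' hα0]
    constructor <;> intro h <;> linarith
  rw [mem_orbitSubLe, mem_orbitSubLe, forall_nat_iff_even_odd]
  simp only [odometer_iterate_even, odometer_iterate_odd_true, odometer_iterate_odd_false,
    kappa_wcons_false hα0 hα1, kappa_wcons_true hα0 hα1, hiff, ← Function.iterate_succ_apply]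
  refine ⟨fun h => h.2, fun h => ⟨fun n => ?_, h⟩⟩
  have h1 := neg_one_le_of_mem_orbitSubLe (p := (u, odometer v)) hα0 hα1 h
  rw [le_div_iff₀ hα0] at h1
  nlinarith [kappa_le_one hα0 hα1 (odometer^[n] u), kappa_nonneg hα0 hα1 (odometer^[n] v)]

theorem measurePreserving_id_odometer :
    MeasurePreserving (fun p : (ℕ → Bool) × (ℕ → Bool) => (p.1, odometer p.2)) coin2 coin2 :=
  (MeasurePreserving.id coin).prod measurePreserving_odometer

theorem measurePreserving_swap_coin2 :
    MeasurePreserving (fun p : (ℕ → Bool) × (ℕ → Bool) => (p.2, p.1)) coin2 coin2 :=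
  Measure.measurePreserving_swap

theorem coin2_real_orbitSubLe_id_odometer (hα0 : 0 < α) (hα1 : α < 1 / 2) (t : ℝ) :
    coin2.real {p | (p.1, odometer p.2) ∈ orbitSubLe α t} = coin2.real (orbitSubLe α t) :=
  measurePreserving_id_odometer.measureReal_preimage
    (measurableSet_orbitSubLe hα0 hα1 t).nullMeasurableSet

theorem coin2_real_orbitSubLe_swap_odometer (hα0 : 0 < α) (hα1 : α < 1 / 2) (t : ℝ) :
    coin2.real {p | (p.2, odometer p.1) ∈ orbitSubLe α t} = coin2.real (orbitSubLe α t) :=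
  (measurePreserving_id_odometer.comp measurePreserving_swap_coin2).measureReal_preimage
    (measurableSet_orbitSubLe hα0 hα1 t).nullMeasurableSet

/-- The supremum along the orbits of the difference of the codes of two independent words has law
`μ_α`. -/
theorem coin2_real_orbitSubLe (hα0 : 0 < α) (hα1 : α < 1 / 2) (t : ℝ) :
    coin2.real (orbitSubLe α t) = cdf α t := by
  have hhalf (t : ℝ) : coin2.real (orbitSubLe α t) = (coin2.real (orbitSubLe α (t / α)) +
      coin2.real (orbitSubLe α ((t - (1 - α)) / α))) / 2 := by
    rw [coin2_real_eq _ (measurableSet_orbitSubLe hα0 hα1 t)]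
    simp only [false_false_mem_orbitSubLe hα0 hα1, true_true_mem_orbitSubLe hα0 hα1,
      true_false_mem_orbitSubLe hα0 hα1, false_true_mem_orbitSubLe hα0 hα1,
      coin2_real_orbitSubLe_id_odometer hα0 hα1]
    simp only [Prod.mk.eta, ofPred_mem_eq]
    ring
  have hneg : ∀ n : ℕ, ∀ t < 0, coin2.real (orbitSubLe α t) ≤ (1 / 2) ^ n := by
    intro n
    induction n with
    | zero => intro t _; rw [pow_zero]; exact measureReal_le_one
    | succ n ih =>
      intro t ht
      have h0 : orbitSubLe α ((t - (1 - α)) / α) = ∅ := by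
        refine eq_empty_of_forall_notMem fun p hp => ?_
        have := neg_one_le_of_mem_orbitSubLe hα0 hα1 hp
        rw [le_div_iff₀ hα0] at this
        linarith
      rw [hhalf, h0, measureReal_empty, pow_succ]
      linarith [ih (t / α) (div_neg_of_neg_of_pos ht hα0)]
  refine IsSelfSimilarCdf.unique hα0 hα1 (Φ := fun t => coin2.real (orbitSubLe α t))
    ⟨fun _ => measureReal_nonneg, fun _ => measureReal_le_one, fun t ht => ?_, fun t ht => ?_,
      hhalf⟩ (isSelfSimilarCdf_cdf hα0 hα1) t
  · exact le_antisymm (ge_of_tendsto' (tendsto_pow_atTop_nhds_zero_of_lt_one (by norm_num)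
      (by norm_num)) fun n => hneg n t ht) measureReal_nonneg
  · simp [orbitSubLe_of_one_le hα0 hα1 ht]

/-- By `true_false_mem_orbitSubLe` and `false_true_mem_orbitSubLe`, the distances along the orbits
of `1 u` and `0 v` are governed by the pairs `(u, v)` and `(v, odometer u)`. Exactly one of these
two pairs has different first letters; it yields the larger supremum, and self-similarity applies to
that pair alone. -/
theorem coin2_real_orbitSubLe_inter (hα0 : 0 < α) (hα1 : α < 1 / 2) (t : ℝ) :
    coin2.real {p | p ∈ orbitSubLe α t ∧ (p.2, odometer p.1) ∈ orbitSubLe α t} =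
      cdf α ((t - (1 - α)) / α) := by
  have hmeas : MeasurableSet {p : (ℕ → Bool) × (ℕ → Bool) |
      p ∈ orbitSubLe α t ∧ (p.2, odometer p.1) ∈ orbitSubLe α t} :=
    (measurableSet_orbitSubLe hα0 hα1 t).inter
      ((measurePreserving_id_odometer.comp measurePreserving_swap_coin2).measurable
        (measurableSet_orbitSubLe hα0 hα1 t))
  rw [coin2_real_eq _ hmeas]
  simp only [mem_ofPred_eq, odometer_wcons_false, odometer_wcons_true,
    false_false_mem_orbitSubLe hα0 hα1, true_true_mem_orbitSubLe hα0 hα1,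
    true_false_mem_orbitSubLe hα0 hα1, false_true_mem_orbitSubLe hα0 hα1]
  set t' := (t - (1 - α)) / α with ht'
  have h1 := coin2_real_orbitSubLe hα0 hα1 t'
  have h2 := coin2_real_orbitSubLe_swap_odometer hα0 hα1 t'
  have h3 := coin2_real_orbitSubLe_id_odometer hα0 hα1 t'
  -- for `t' < 0` all terms vanish; for `t' ≥ 0` the condition on the other pair is void
  rcases lt_or_ge t' 0 with hneg | hpos
  · have h0 := (isSelfSimilarCdf_cdf hα0 hα1).eq_zero t' hneg
    rw [h1, h0] at h2 h3
    rw [h0] at h1 ⊢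
    have e1 := measureReal_mono_null (μ := coin2) (s₁ := {p | (p.1, p.2) ∈ orbitSubLe α (t / α) ∧
      (p.2, odometer p.1) ∈ orbitSubLe α t'}) (fun p hp => hp.2) h2
    have e2 := measureReal_mono_null (μ := coin2) (s₁ := {p | (p.1, p.2) ∈ orbitSubLe α t' ∧
      (p.2, odometer p.1) ∈ orbitSubLe α (t / α)}) (fun p hp => hp.1) h1
    have e3 := measureReal_mono_null (μ := coin2)
      (s₁ := {p | (p.1, odometer p.2) ∈ orbitSubLe α t' ∧ (p.2, p.1) ∈ orbitSubLe α (t / α)})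
      (fun p hp => hp.1) h3
    rw [e1, e2, e3]
    norm_num
  · have ht : 1 ≤ t / α := by
      rw [ht', le_div_iff₀ hα0] at hpos
      exact (one_le_div hα0).2 (by linarith)
    simp only [orbitSubLe_of_one_le hα0 hα1 ht, mem_univ, true_and, and_true, h2, h3]
    simp only [Prod.mk.eta, ofPred_mem_eq, h1]
    ring

/-- The correlation integral of `μ_α` along whole orbits, on the coding space. -/
noncomputable def corrTop (α ε : ℝ) : ℝ :=
  coin2.real {p | p ∈ orbitSubLe α ε ∧ p.swap ∈ orbitSubLe α ε}

/-- Self-similarity of the correlation integral along orbits: equal first letters rescale `ε`, and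
different first letters lead to `coin2_real_orbitSubLe_inter`. -/
theorem corrTop_eq_half (hα0 : 0 < α) (hα1 : α < 1 / 2) (ε : ℝ) :
    corrTop α ε = (corrTop α (ε / α) + cdf α ((ε - (1 - α ^ 2)) / α ^ 2)) / 2 := by
  have hm := measurableSet_orbitSubLe hα0 hα1
  have hτ : ((ε - (1 - α)) / α - (1 - α)) / α = (ε - (1 - α ^ 2)) / α ^ 2 := by
    field_simp; ring
  have h1 := coin2_real_orbitSubLe_inter hα0 hα1 ((ε - (1 - α)) / α)
  have hset (t : ℝ) : MeasurableSet {p : (ℕ → Bool) × (ℕ → Bool) |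
      p ∈ orbitSubLe α t ∧ (p.2, odometer p.1) ∈ orbitSubLe α t} :=
    (hm t).inter ((measurePreserving_id_odometer.comp measurePreserving_swap_coin2).measurable
      (hm t))
  have hset' (t : ℝ) : MeasurableSet {p : (ℕ → Bool) × (ℕ → Bool) |
      p ∈ orbitSubLe α t ∧ p.swap ∈ orbitSubLe α t} :=
    (hm t).inter (measurable_swap (hm t))
  have h2 : coin2.real {p : (ℕ → Bool) × (ℕ → Bool) |
      (p.1, odometer p.2) ∈ orbitSubLe α ((ε - (1 - α)) / α) ∧
      (p.2, p.1) ∈ orbitSubLe α ((ε - (1 - α)) / α)} =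
      coin2.real {p | p ∈ orbitSubLe α ((ε - (1 - α)) / α) ∧
      (p.2, odometer p.1) ∈ orbitSubLe α ((ε - (1 - α)) / α)} := by
    rw [← measurePreserving_swap_coin2.measureReal_preimage (hset _).nullMeasurableSet]
    congr 1
    ext p
    exact and_comm
  unfold corrTop
  rw [coin2_real_eq _ (hset' ε)]
  simp only [mem_ofPred_eq, Prod.swap_prod_mk,
    false_false_mem_orbitSubLe hα0 hα1, true_true_mem_orbitSubLe hα0 hα1,
    true_false_mem_orbitSubLe hα0 hα1, false_true_mem_orbitSubLe hα0 hα1]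
  rw [h2]
  simp only [Prod.mk.eta] at h1 ⊢
  rw [h1, hτ]
  simp only [Prod.swap]
  ring

theorem corrTop_of_one_le (hα0 : 0 < α) (hα1 : α < 1 / 2) {ε : ℝ} (hε : 1 ≤ ε) :
    corrTop α ε = 1 := by
  simp [corrTop, orbitSubLe_of_one_le hα0 hα1 hε]

theorem corrTop_le_corrOne (α ε : ℝ) : corrTop α ε ≤ corrOne α ε := by
  refine measureReal_mono fun p ⟨h1, h2⟩ => ?_
  have h1 := h1 0
  have h2 := h2 0
  exact abs_le'.2 ⟨h1, by simpa using h2⟩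

theorem corrTop_pow_mul (hα0 : 0 < α) (hα1 : α < 1 / 2) {s : ℝ} (hs : s ∈ Icc α 1) (n : ℕ) :
    corrTop α (α ^ n * s) = (1 + cdf α ((s - (1 - α ^ 2)) / α ^ 2)) / 2 ^ (n + 1) := by
  induction n with
  | zero =>
    rw [pow_zero, one_mul, corrTop_eq_half hα0 hα1,
      corrTop_of_one_le hα0 hα1 ((one_le_div hα0).2 hs.1)]
    norm_num
  | succ n ih =>
    have h1 : α ^ n * s ≤ 1 :=
      mul_le_one₀ (pow_le_one₀ hα0.le (by linarith)) (hα0.le.trans hs.1) hs.2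
    rw [pow_succ', mul_assoc, corrTop_eq_half hα0 hα1, mul_div_cancel_left₀ _ hα0.ne', ih,
      cdf_of_nonpos hα0 hα1 (t := (α * (α ^ n * s) - (1 - α ^ 2)) / α ^ 2), pow_succ 2 (n + 1)]
    · field_simp; ring
    · exact div_nonpos_of_nonpos_of_nonneg (by nlinarith) (by positivity)

/-! ### The asymptotic determinism -/

theorem prod_mu (hα0 : 0 < α) (hα1 : α < 1 / 2) :
    (mu α).prod (mu α) = coin2.map (Prod.map (kappa α) (kappa α)) :=
  Measure.map_prod_map _ _ (measurable_kappa hα0 hα1) (measurable_kappa hα0 hα1)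

theorem edist_le_ofReal_iff {x y ε : ℝ} (hε : 0 ≤ ε) :
    edist x y ≤ ENNReal.ofReal ε ↔ |x - y| ≤ ε := by
  rw [edist_dist, ENNReal.ofReal_le_ofReal_iff hε, Real.dist_eq]

theorem corrIntegral_one_eq (hα0 : 0 < α) (hα1 : α < 1 / 2) {ε : ℝ} (hε : 0 ≤ ε) :
    corrIntegral (f α) (mu α) 1 ε = corrOne α ε := by
  have hκ := measurable_kappa hα0 hα1
  have hset : {p : ℝ × ℝ | orbitDist (f α) 1 p.1 p.2 ≤ ENNReal.ofReal ε} =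
      {p | |p.1 - p.2| ≤ ε} := by
    ext p
    simp only [mem_ofPred_eq, orbitDist, iSup_le_iff, ← edist_le_ofReal_iff hε]
    refine ⟨fun h => h 0 (by simp), fun h i hi => ?_⟩
    obtain rfl : i = 0 := by
      have : i < 1 := by exact_mod_cast hi
      omega
    exact h
  have hmeas : MeasurableSet {p : ℝ × ℝ | |p.1 - p.2| ≤ ε} :=
    measurableSet_le (measurable_fst.sub measurable_snd).abs measurable_const
  rw [corrIntegral, hset, prod_mu hα0 hα1, map_measureReal_apply (hκ.prodMap hκ) hmeas]
  rfl

theorem corrIntegral_top_eq (hα0 : 0 < α) (hα1 : α < 1 / 2) {ε : ℝ} (hε : 0 ≤ ε) :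
    corrIntegral (f α) (mu α) ⊤ ε = corrTop α ε := by
  have hκ := measurable_kappa hα0 hα1
  have hset : {p : ℝ × ℝ | orbitDist (f α) ⊤ p.1 p.2 ≤ ENNReal.ofReal ε} =
      ⋂ i : ℕ, {p | |(f α)^[i] p.1 - (f α)^[i] p.2| ≤ ε} := by
    ext p
    simp only [mem_ofPred_eq, orbitDist, iSup_le_iff, ← edist_le_ofReal_iff hε, mem_iInter]
    exact ⟨fun h i => h i (ENat.natCast_lt_top i), fun h i _ => h i⟩
  have hmeas : MeasurableSet (⋂ i : ℕ, {p : ℝ × ℝ | |(f α)^[i] p.1 - (f α)^[i] p.2| ≤ ε}) :=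
    MeasurableSet.iInter fun i => measurableSet_le
      ((((measurable_f hα0 hα1).iterate i).comp measurable_fst).sub
        (((measurable_f hα0 hα1).iterate i).comp measurable_snd)).abs measurable_const
  rw [corrIntegral, hset, prod_mu hα0 hα1, map_measureReal_apply (hκ.prodMap hκ) hmeas, corrTop]
  congr 1
  ext ⟨u, v⟩
  simp only [mem_preimage, mem_iInter, mem_ofPred_eq, Prod.map, iterate_f_kappa hα0 hα1,
    Prod.swap_prod_mk, mem_orbitSubLe, abs_le', neg_sub, forall_and]

theorem det_eq (hα0 : 0 < α) (hα1 : α < 1 / 2) {ε : ℝ} (hε : 0 ≤ ε) :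
    det α ε = corrTop α ε / corrOne α ε := by
  rw [det, asympDetInfty, corrIntegral_one_eq hα0 hα1 hε, corrIntegral_top_eq hα0 hα1 hε]

theorem mul_one_sub_sq_eq (α : ℝ) (h : ℕ) : α ^ h * (1 - α ^ 2) = α ^ h - α ^ (h + 2) := by ring

theorem one_sub_sq_mem_Icc (hα0 : 0 < α) (hα1 : α < 1 / 2) : 1 - α ^ 2 ∈ Icc α 1 :=
  ⟨by nlinarith, by nlinarith⟩

theorem det_pow_mul (hα0 : 0 < α) (hα1 : α < 1 / 2) {s : ℝ} (hs : s ∈ Icc α 1) (h : ℕ) :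
    det α (α ^ h * s) =
      (1 + cdf α ((s - (1 - α ^ 2)) / α ^ 2)) / 2 ^ (h + 1) / corrOne α (α ^ h * s) := by
  rw [det_eq hα0 hα1 (mul_nonneg (by positivity) (hα0.le.trans hs.1)),
    corrTop_pow_mul hα0 hα1 hs]

theorem det_pow_mul_of_le (hα0 : 0 < α) (hα1 : α < 1 / 2) {s : ℝ} (hs : α ≤ s)
    (hs' : s ≤ 1 - α ^ 2) (h : ℕ) :
    det α (α ^ h * s) = 1 / 2 ^ (h + 1) / corrOne α (α ^ h * s) := by
  rw [det_pow_mul hα0 hα1 ⟨hs, hs'.trans (by nlinarith)⟩, cdf_of_nonpos hα0 hα1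
    (div_nonpos_of_nonpos_of_nonneg (by linarith) (by positivity)), add_zero]

theorem det_le_one (hα0 : 0 < α) (hα1 : α < 1 / 2) {ε : ℝ} (hε : 0 < ε) : det α ε ≤ 1 := by
  rw [det_eq hα0 hα1 hε.le]
  exact (div_le_one (corrOne_pos hα0 hα1 hε)).2 (corrTop_le_corrOne α ε)

theorem le_corrOne_pow_mul_one_sub_sq (hα0 : 0 < α) (hα1 : α < 1 / 2) (h : ℕ) :
    15 / 16 / 2 ^ h ≤ corrOne α (α ^ h * (1 - α ^ 2)) := by
  rw [← corrOne_one_sub_sq hα0 hα1]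
  exact corrOne_div_two_pow_le hα0 hα1 _ h

/-- To the left of `α ^ h (1 - α²)` the numerator of the determinism is constant and the
denominator strictly increasing; to the right the relative growth of the numerator, governed by
`cdf`, beats that of the denominator by subadditivity. -/
theorem det_pow_mul_lt (hα0 : 0 < α) (hα1 : α < 1 / 2) (h : ℕ) {s : ℝ} (hs : s ∈ Icc α 1)
    (hne : s ≠ 1 - α ^ 2) : det α (α ^ h * (1 - α ^ 2)) < det α (α ^ h * s) := by
  have hs0 : 0 < s := hα0.trans_le hs.1
  have h0 := one_sub_sq_mem_Icc hα0 hα1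
  have hG := corrOne_pos hα0 hα1 (show 0 < α ^ h * s by positivity)
  have hG0 := corrOne_pos hα0 hα1 (mul_pos (pow_pos hα0 h) (hα0.trans_le h0.1))
  rcases lt_or_gt_of_ne hne with hlt | hgt
  · rw [det_pow_mul_of_le hα0 hα1 h0.1 le_rfl, det_pow_mul_of_le hα0 hα1 hs.1 hlt.le]
    exact div_lt_div_of_pos_left (by positivity) hG
      (corrOne_mul_strict hα0 hα1 hlt.le (corrOne_lt_of_lt hα0 hα1 hlt) h)
  · set τ := (s - (1 - α ^ 2)) / α ^ 2 with hτ
    have hτ0 : 0 < τ := div_pos (by linarith) (by positivity)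
    have hτ1 : τ ≤ 1 := (div_le_one (by positivity)).2 (by linarith [hs.2])
    have hF := cdf_pos hα0 hα1 hτ0
    have hinc := corrOne_sub_le hα0 hα1 (a := α ^ h * (1 - α ^ 2)) (b := α ^ h * s)
      (mul_nonneg (by positivity) (hα0.le.trans h0.1)) (by gcongr)
    have hdiff : α ^ h * s - α ^ h * (1 - α ^ 2) = α ^ (h + 2) * τ := by
      rw [hτ, pow_add]; field_simp
    rw [hdiff, cdf_pow_mul hα0 hα1 hτ0.le hτ1] at hinc
    have hlow := mul_le_mul_of_nonneg_left (le_corrOne_pow_mul_one_sub_sq hα0 hα1 h) hF.le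
    have hpos : 0 < cdf α τ / 2 ^ h := by positivity
    have e1 : cdf α τ * (15 / 16 / 2 ^ h) = 15 / 16 * (cdf α τ / 2 ^ h) := by ring
    have e2 : 2 * (cdf α τ / 2 ^ (h + 2)) = 1 / 2 * (cdf α τ / 2 ^ h) := by
      rw [pow_add]; ring
    rw [e1] at hlow
    rw [e2] at hinc
    rw [det_pow_mul_of_le hα0 hα1 h0.1 le_rfl, det_pow_mul hα0 hα1 hs, div_lt_div_iff₀ hG0 hG,
      div_mul_eq_mul_div, div_mul_eq_mul_div]
    refine div_lt_div_of_pos_right ?_ (by positivity)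
    linarith

theorem det_lt_of_mem_Icc (hα0 : 0 < α) (hα1 : α < 1 / 2) (h : ℕ) {ε : ℝ}
    (hε : ε ∈ Icc (α ^ (h + 1)) (α ^ h)) (hne : ε ≠ α ^ h - α ^ (h + 2)) :
    det α (α ^ h - α ^ (h + 2)) < det α ε := by
  have hp := pow_pos hα0 h
  have hmul : ε = α ^ h * (ε / α ^ h) := by field_simp
  rw [← mul_one_sub_sq_eq] at hne ⊢
  rw [hmul]
  refine det_pow_mul_lt hα0 hα1 h ⟨?_, (div_le_one hp).2 hε.2⟩ fun h' => hne ?_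
  · rw [le_div_iff₀ hp, ← pow_succ']; exact hε.1
  · rw [hmul, h']

theorem le_det_of_mem_Icc (hα0 : 0 < α) (hα1 : α < 1 / 2) (h : ℕ) {ε : ℝ}
    (hε : ε ∈ Icc (α ^ (h + 1)) (α ^ h)) : det α (α ^ h - α ^ (h + 2)) ≤ det α ε := by
  rcases eq_or_ne ε (α ^ h - α ^ (h + 2)) with rfl | hne
  · exact le_rfl
  · exact (det_lt_of_mem_Icc hα0 hα1 h hε hne).le

theorem isLocalMin_det (hα0 : 0 < α) (hα1 : α < 1 / 2) (h : ℕ) :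
    IsLocalMin (det α) (α ^ h - α ^ (h + 2)) := by
  have hp := pow_pos hα0 h
  have hmem : Icc (α ^ (h + 1)) (α ^ h) ∈ 𝓝 (α ^ h - α ^ (h + 2)) := by
    rw [← mul_one_sub_sq_eq]
    exact Icc_mem_nhds (by rw [pow_succ]; gcongr; nlinarith)
      (mul_lt_of_lt_one_right hp (by nlinarith))
  filter_upwards [hmem] with ε hε using le_det_of_mem_Icc hα0 hα1 h hε

theorem det_min_eq (hα0 : 0 < α) (hα1 : α < 1 / 2) (h : ℕ) :
    det α (α ^ h - α ^ (h + 2)) = 1 / 2 ^ (h + 1) / corrOne α (α ^ h * (1 - α ^ 2)) := by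
  rw [← mul_one_sub_sq_eq,
    det_pow_mul_of_le hα0 hα1 (one_sub_sq_mem_Icc hα0 hα1).1 le_rfl]

theorem det_min_le (hα0 : 0 < α) (hα1 : α < 1 / 2) (h : ℕ) :
    det α (α ^ h - α ^ (h + 2)) ≤ 8 / 15 := by
  have hle := le_corrOne_pow_mul_one_sub_sq hα0 hα1 h
  rw [det_min_eq hα0 hα1, div_le_iff₀ (lt_of_lt_of_le (by positivity) hle)]
  refine le_trans (le_of_eq ?_) (mul_le_mul_of_nonneg_left hle (by norm_num))
  rw [pow_succ]; field_simp; norm_num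

theorem le_det_min (hα0 : 0 < α) (hα1 : α < 1 / 2) (h : ℕ) :
    1 / 3 ≤ det α (α ^ h - α ^ (h + 2)) := by
  have h0 := one_sub_sq_mem_Icc hα0 hα1
  have hnn : 0 ≤ 1 - α ^ 2 := hα0.le.trans h0.1
  have hsq : cdf α (α ^ 2) = 1 / 4 := by
    have := cdf_pow_mul hα0 hα1 zero_le_one le_rfl 2
    rw [mul_one, (isSelfSimilarCdf_cdf hα0 hα1).eq_one 1 le_rfl] at this
    rw [this]; norm_num
  have hle := corrOne_le_two_mul_cdf hα0 hα1 (ε := α ^ h * (1 - α ^ 2))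
    (mul_nonneg (by positivity) hnn)
  rw [cdf_pow_mul hα0 hα1 hnn h0.2, cdf_one_sub hα0 hα1, hsq] at hle
  have hpos := corrOne_pos hα0 hα1 (mul_pos (pow_pos hα0 h) (hα0.trans_le h0.1))
  rw [det_min_eq hα0 hα1, le_div_iff₀ hpos]
  refine (mul_le_mul_of_nonneg_left hle (by norm_num)).trans (le_of_eq ?_)
  rw [pow_succ]; field_simp; norm_num

theorem exists_le_det (hα0 : 0 < α) (hα1 : α < 1 / 2) {ε : ℝ} (hε : ε ∈ Ioc (0 : ℝ) 1) :
    ∃ h : ℕ, det α (α ^ h - α ^ (h + 2)) ≤ det α ε := by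
  obtain ⟨h, h1, h2⟩ := exists_nat_pow_near_of_lt_one hε.1 hε.2 hα0 (by linarith)
  exact ⟨h, le_det_of_mem_Icc hα0 hα1 h ⟨h1.le, h2⟩⟩

/-! ### Ratios above one third -/

theorem det_pow_succ_mul_le (hα0 : 0 < α) (hα1 : α < 1 / 2) {s : ℝ} (hs : s ∈ Icc α 1) (n : ℕ) :
    det α (α ^ (n + 1) * s) ≤ (1 + cdf α ((s - (1 - α ^ 2)) / α ^ 2)) / 2 /
      (corrOne α s + diffCdf α (s - (1 - α) / α)) := by
  have hs0 : 0 < s := hα0.trans_le hs.1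
  have hF := (isSelfSimilarCdf_cdf hα0 hα1).nonneg ((s - (1 - α ^ 2)) / α ^ 2)
  have hG := corrOne_pos hα0 hα1 hs0
  have hQ := diffCdf_nonneg α (s - (1 - α) / α)
  have hle := corrOne_div_two_pow_le hα0 hα1 (α * s) n
  rw [← mul_assoc, ← pow_succ, corrOne_mul hα0 hα1] at hle
  rw [det_pow_mul hα0 hα1 hs]
  refine (div_le_div_of_nonneg_left (by positivity) (by positivity) hle).trans (le_of_eq ?_)
  rw [pow_succ (2 : ℝ) (n + 1), pow_succ (2 : ℝ) n]
  field_simp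

/-- For `α > 1/3`, pairs of words whose first difference occurs one letter earlier contribute to
the first correlation integral near `α ^ h`, but not to the correlation integral along orbits. Away
from these points, the bound `1 - corrOne ≤ 2 (1 - cdf)` keeps the determinism away from `1`. -/
theorem exists_det_le (hα0 : 0 < α) (hα1 : α < 1 / 2) (hα : 1 / 3 < α) :
    ∃ c < 1, ∀ ε ∈ Ioc (0 : ℝ) α, det α ε ≤ c := by
  have hF := isSelfSimilarCdf_cdf hα0 hα1
  have hr1 : (1 - α) / α < 2 := (div_lt_iff₀ hα0).2 (by linarith)
  -- the midpoint of `(1 - α) / α - 1` and `1`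
  set s₁ := (1 - α) / α / 2 with hs₁
  set q := diffCdf α (s₁ - (1 - α) / α) with hq
  have hq0 : 0 < q := diffCdf_pos hα0 hα1 (by linarith)
  set p₁ := 1 - cdf α ((s₁ - (1 - α ^ 2)) / α ^ 2) with hp₁
  have hp₁0 : 0 < p₁ := by
    rw [hp₁, ← cdf_one_sub hα0 hα1]
    refine cdf_pos hα0 hα1 (sub_pos.2 ((div_lt_one (by positivity)).2 ?_))
    linarith
  have hGα : 1 / 2 < corrOne α α := by
    have hm1 : -1 < (α - (1 - α)) / α := by rw [lt_div_iff₀ hα0]; linarith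
    have := diffCdf_pos hα0 hα1 hm1
    rw [corrOne_eq_half hα0 hα1, div_self hα0.ne', corrOne_of_one_le hα0 hα1 le_rfl]
    linarith
  refine ⟨max (1 / (1 + q)) (max (1 - 3 / 8 * p₁) (1 / 2 / corrOne α α)),
    max_lt ((div_lt_one (by linarith)).2 (by linarith))
      (max_lt (by linarith) ((div_lt_one (by linarith)).2 hGα)), ?_⟩
  rintro ε ⟨hε0, hεα⟩
  obtain ⟨n, hn1, hn2⟩ := exists_nat_pow_near_of_lt_one (x := ε / α) (div_pos hε0 hα0)
    ((div_le_one hα0).2 hεα) hα0 (by linarith)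
  have hp := pow_pos hα0 n
  obtain ⟨s, hs, rfl⟩ : ∃ s ∈ Icc α 1, ε = α ^ (n + 1) * s := by
    refine ⟨ε / α / α ^ n, ⟨?_, (div_le_one hp).2 hn2⟩, by rw [pow_succ]; field_simp⟩
    rw [le_div_iff₀ hp, ← pow_succ']; exact hn1.le
  refine (det_pow_succ_mul_le hα0 hα1 hs n).trans ?_
  have hQ := diffCdf_nonneg α (s - (1 - α) / α)
  set τ := (s - (1 - α ^ 2)) / α ^ 2 with hτ
  have hF0 := hF.nonneg τ
  have hF1 := hF.le_one τ
  have hCG : (1 + cdf α τ) / 2 ≤ corrOne α s := by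
    have h1 := corrTop_pow_mul hα0 hα1 hs 0
    have h2 := corrTop_le_corrOne α s
    rw [pow_zero, one_mul, zero_add, pow_one] at h1
    rwa [h1] at h2
  have hG0 : 0 < corrOne α s := by linarith
  rcases le_total s₁ s with h1 | h1
  · refine le_max_of_le_left ?_
    have hqle : q ≤ diffCdf α (s - (1 - α) / α) := diffCdf_mono α (by linarith)
    rw [div_le_div_iff₀ (by linarith) (by linarith)]
    nlinarith
  refine le_max_of_le_right ?_
  refine (div_le_div_of_nonneg_left (by linarith) hG0 (le_add_of_nonneg_right hQ)).trans ?_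
  rcases le_total (1 - α ^ 2) s with h2 | h2
  · refine le_max_of_le_left ?_
    have hp1 : p₁ ≤ 1 - cdf α τ := by
      have := cdf_mono α (show τ ≤ (s₁ - (1 - α ^ 2)) / α ^ 2 by rw [hτ]; gcongr)
      linarith
    have h3 := corrOne_near_one hα0 hα1 h2
    have h4 := one_sub_corrOne_le hα0 hα1 τ
    have h5 : 1 - (1 - cdf α τ) / 8 ≤ corrOne α s := by linarith
    rw [div_le_iff₀ hG0]
    have h6 : (1 - 3 / 8 * (1 - cdf α τ)) * (1 - (1 - cdf α τ) / 8) ≤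
        (1 - 3 / 8 * p₁) * corrOne α s :=
      mul_le_mul (by linarith) h5 (by linarith) (by linarith)
    nlinarith [sq_nonneg (1 - cdf α τ)]
  · refine le_max_of_le_right ?_
    have h0 : cdf α τ = 0 := cdf_of_nonpos hα0 hα1
      (div_nonpos_of_nonpos_of_nonneg (by linarith) (by positivity))
    rw [h0, add_zero]
    exact div_le_div_of_nonneg_left (by norm_num) (by linarith) (corrOne_mono α hs.1)

/-! ### Ratios up to one third -/

/-- For `α ≤ 1/3` words with different first letters have codes at distance at least `α`, so that
the first correlation integral scales exactly. -/
theorem corrOne_pow_mul (hα0 : 0 < α) (hα : α ≤ 1 / 3) {s : ℝ} (hs0 : 0 ≤ s) (hs1 : s ≤ 1)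
    (n : ℕ) : corrOne α (α ^ n * s) = corrOne α s / 2 ^ n := by
  have hα1 : α < 1 / 2 := by linarith
  have hr : 2 ≤ (1 - α) / α := (le_div_iff₀ hα0).2 (by linarith)
  induction n with
  | zero => simp
  | succ n ih =>
    have h1 : α ^ n * s ≤ 1 := mul_le_one₀ (pow_le_one₀ hα0.le (by linarith)) hs0 hs1
    rw [pow_succ' α, mul_assoc, corrOne_mul hα0 hα1, ih,
      diffCdf_of_le_neg_one hα0 hα1 (t := α ^ n * s - (1 - α) / α) (by linarith), pow_succ]
    field_simp; ring

theorem det_min_of_le_third (hα0 : 0 < α) (hα : α ≤ 1 / 3) (h : ℕ) :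
    det α (α ^ h - α ^ (h + 2)) = 8 / 15 := by
  have hα1 : α < 1 / 2 := by linarith
  have h0 := one_sub_sq_mem_Icc hα0 hα1
  rw [det_min_eq hα0 hα1, corrOne_pow_mul hα0 hα (hα0.le.trans h0.1) h0.2,
    corrOne_one_sub_sq hα0 hα1, pow_succ]
  field_simp; norm_num

theorem det_pow_of_le_third (hα0 : 0 < α) (hα : α ≤ 1 / 3) (h : ℕ) : det α (α ^ h) = 1 := by
  have hα1 : α < 1 / 2 := by linarith
  have h1 := det_pow_mul hα0 hα1 (s := 1) ⟨by linarith, le_rfl⟩ h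
  rw [corrOne_pow_mul hα0 hα zero_le_one le_rfl, corrOne_of_one_le hα0 hα1 le_rfl,
    sub_sub_cancel, div_self (by positivity), (isSelfSimilarCdf_cdf hα0 hα1).eq_one 1 le_rfl,
    mul_one] at h1
  rw [h1, pow_succ]
  field_simp; norm_num

/-! ### Limits at zero -/

theorem tendsto_pow_mul_nhdsGT_zero (hα0 : 0 < α) (hα1 : α < 1) {s : ℝ} (hs : 0 < s) :
    Filter.Tendsto (fun h : ℕ => α ^ h * s) Filter.atTop (𝓝[>] 0) := by
  refine tendsto_nhdsWithin_iff.2 ⟨?_, Filter.Eventually.of_forall fun h => ?_⟩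
  · simpa using (tendsto_pow_atTop_nhds_zero_of_lt_one hα0.le hα1).mul_const s
  · exact mem_Ioi.2 (by positivity)

theorem third_le_det (hα0 : 0 < α) (hα1 : α < 1 / 2) {ε : ℝ} (hε : ε ∈ Ioc (0 : ℝ) 1) :
    1 / 3 ≤ det α ε := by
  obtain ⟨h, hh⟩ := exists_le_det hα0 hα1 hε
  exact (le_det_min hα0 hα1 h).trans hh

theorem eventually_mem_Ioc {a : ℝ} (ha : 0 < a) : ∀ᶠ ε in 𝓝[>] (0 : ℝ), ε ∈ Ioc 0 a :=
  Ioc_mem_nhdsGT ha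

theorem isBoundedUnder_le_det (hα0 : 0 < α) (hα1 : α < 1 / 2) :
    (𝓝[>] (0 : ℝ)).IsBoundedUnder (· ≤ ·) (det α) :=
  ⟨1, Filter.eventually_map.2 ((eventually_mem_Ioc one_pos).mono fun _ hε =>
    det_le_one hα0 hα1 hε.1)⟩

theorem isBoundedUnder_ge_det (hα0 : 0 < α) (hα1 : α < 1 / 2) :
    (𝓝[>] (0 : ℝ)).IsBoundedUnder (· ≥ ·) (det α) :=
  ⟨1 / 3, Filter.eventually_map.2 ((eventually_mem_Ioc one_pos).mono fun _ hε =>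
    third_le_det hα0 hα1 hε)⟩

theorem le_liminf_det (hα0 : 0 < α) (hα1 : α < 1 / 2) {c : ℝ}
    (hc : ∀ h : ℕ, c ≤ det α (α ^ h - α ^ (h + 2))) :
    c ≤ Filter.liminf (det α) (𝓝[>] (0 : ℝ)) := by
  refine Filter.le_liminf_of_le (isBoundedUnder_le_det hα0 hα1).isCoboundedUnder_ge ?_
  filter_upwards [eventually_mem_Ioc one_pos] with ε hε
  obtain ⟨h, hh⟩ := exists_le_det hα0 hα1 hε
  exact (hc h).trans hh

theorem liminf_det_le (hα0 : 0 < α) (hα1 : α < 1 / 2) :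
    Filter.liminf (det α) (𝓝[>] (0 : ℝ)) ≤ 8 / 15 := by
  refine Filter.liminf_le_of_frequently_le ?_ (isBoundedUnder_ge_det hα0 hα1)
  refine (tendsto_pow_mul_nhdsGT_zero hα0 (by linarith)
    (hα0.trans_le (one_sub_sq_mem_Icc hα0 hα1).1)).frequently
    (Filter.Frequently.of_forall fun h => ?_)
  rw [mul_one_sub_sq_eq]
  exact det_min_le hα0 hα1 h

theorem limsup_det_le (hα0 : 0 < α) (hα1 : α < 1 / 2) {a c : ℝ} (ha : 0 < a)
    (hc : ∀ ε ∈ Ioc 0 a, det α ε ≤ c) : Filter.limsup (det α) (𝓝[>] (0 : ℝ)) ≤ c :=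
  Filter.limsup_le_of_le (isBoundedUnder_ge_det hα0 hα1).isCoboundedUnder_le
    ((eventually_mem_Ioc ha).mono hc)

theorem limsup_det_of_le_third (hα0 : 0 < α) (hα : α ≤ 1 / 3) :
    Filter.limsup (det α) (𝓝[>] (0 : ℝ)) = 1 := by
  have hα1 : α < 1 / 2 := by linarith
  refine le_antisymm (limsup_det_le hα0 hα1 one_pos fun ε hε => det_le_one hα0 hα1 hε.1) ?_
  refine Filter.le_limsup_of_frequently_le ?_ (isBoundedUnder_le_det hα0 hα1)
  refine (tendsto_pow_mul_nhdsGT_zero hα0 (by linarith) one_pos).frequently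
    (Filter.Frequently.of_forall fun h => ?_)
  rw [mul_one, det_pow_of_le_third hα0 hα]

end Delahaye

theorem mainTheorem1 (α : ℝ) (hα0 : 0 < α) (hα1 : α < 1 / 2) :
    -- the measure `μ_α` is a non-atomic ergodic probability measure on `[0, 1]`
    (MeasureTheory.IsProbabilityMeasure (Delahaye.mu α) ∧
      Delahaye.mu α (Set.Icc 0 1)ᶜ = 0 ∧
      (∀ x : ℝ, Delahaye.mu α {x} = 0) ∧
      Ergodic (Delahaye.f α) (Delahaye.mu α)) ∧
    -- local minima at `α^h - α^(h+2)`, the only point of `[α^(h+1), α^h]` with the least value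
    (∀ h : ℕ,
      IsLocalMin (Delahaye.det α) (α ^ h - α ^ (h + 2)) ∧
      ∀ ε ∈ Set.Icc (α ^ (h + 1)) (α ^ h), ε ≠ α ^ h - α ^ (h + 2) →
        Delahaye.det α (α ^ h - α ^ (h + 2)) < Delahaye.det α ε) ∧
    -- the lower limit
    Filter.liminf (Delahaye.det α) (𝓝[>] (0 : ℝ)) ∈ Set.Icc (1 / 3 : ℝ) (8 / 15) ∧
    -- the upper limit
    (α ≤ 1 / 3 → Filter.limsup (Delahaye.det α) (𝓝[>] (0 : ℝ)) = 1) ∧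
    (1 / 3 < α → Filter.limsup (Delahaye.det α) (𝓝[>] (0 : ℝ)) < 1) ∧
    -- the extremes for `α ≤ 1/3`
    (α ≤ 1 / 3 →
      Filter.liminf (Delahaye.det α) (𝓝[>] (0 : ℝ)) = 8 / 15 ∧
      (∀ ε ∈ Set.Ioc (0 : ℝ) 1, Delahaye.det α ε ∈ Set.Icc (8 / 15 : ℝ) 1) ∧
      (∀ h : ℕ, Delahaye.det α (α ^ h - α ^ (h + 2)) = 8 / 15) ∧
      (∀ h : ℕ, Delahaye.det α (α ^ h) = 1)) := by
  open Delahaye in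
  refine ⟨⟨isProbabilityMeasure_mu hα0 hα1, mu_compl_Icc hα0 hα1, mu_singleton hα0 hα1,
    ergodic_f hα0 hα1⟩, fun h => ⟨isLocalMin_det hα0 hα1 h, fun ε => det_lt_of_mem_Icc hα0 hα1 h⟩,
    ⟨le_liminf_det hα0 hα1 (le_det_min hα0 hα1), liminf_det_le hα0 hα1⟩,
    limsup_det_of_le_third hα0, fun hα => ?_, fun hα => ⟨?_, fun ε hε => ⟨?_, ?_⟩,
      det_min_of_le_third hα0 hα, det_pow_of_le_third hα0 hα⟩⟩
  · obtain ⟨c, hc1, hc⟩ := exists_det_le hα0 hα1 hα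
    exact (limsup_det_le hα0 hα1 hα0 hc).trans_lt hc1
  · exact le_antisymm (liminf_det_le hα0 hα1)
      (le_liminf_det hα0 hα1 fun h => (det_min_of_le_third hα0 hα h).ge)
  · obtain ⟨h, hh⟩ := exists_le_det hα0 hα1 hε
    rwa [det_min_of_le_third hα0 hα] at hh
  · exact det_le_one hα0 hα1 hε.1
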